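/- Let $\mathbb F$ be a field of characteristic different from $2$ and $3$, and let $L = L_{\bar 0}\oplus L_{\bar 1}$ be a finite-dimensional nilpotent Lie superalgebra over $\mathbb F$. Let $(m\mid n)$ be its superdimension, that is, $\dim L_{\bar 0}=m$ and $\dim L_{\bar 1}=n$, and let $(r\mid s)$ be the superdimension of its derived subalgebra $L'=[L,L]$. Assume that $r+s\ge 1$. Let $\mathcal M(L)$ be the multiplier of $L$: for a free presentation $0\to R\to \mathcal F\to L\to 0$ of $L$, where $\mathcal F$ is a free Lie superalgebra on a $\mathbb Z_2$-graded set, $$\mathcal M(L)=\frac{[\mathcal F,\mathcal F]\cap R}{[\mathcal F,R]}.$$ Then, for every free presentation of $L$, the space $\mathcal M(L)$ is finite-dimensional, and its (total) dimension satisfies $$\dim \mathcal M(L)\le \tfrac12\,(m+n+r+s-2)(m+n-r-s-1)+n+1 .$$ Moreover, if $r+s=1$, then equality holds if and only if $m\ge 3$ and $$L\cong H(1,0)\oplus A(m-3\mid n),$$ where $A(m-3\mid n)$ is the abelian Lie superalgebra of superdimension $(m-3\mid n)$, and $H(1,0)$ is the Heisenberg Lie superalgebra of superdimension $(3\mid 0)$: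 it has a basis $x_1,x_2,z$ of even elements, with $[x_1,x_2]=z=-[x_2,x_1]$ and all other brackets of basis elements zero. -/

import Mathlib

universe u v w

/-- The Koszul sign `(-1)^{ij}`, for `i j : ZMod 2`. -/
def koszulSign (F : Type u) [Field F] (i j : ZMod 2) : F := (-1) ^ (i.val * j.val)

theorem ZMod.eq_zero_or_one_of_two (i : ZMod 2) : i = 0 ∨ i = 1 := by
  revert i; decide

theorem koszulSign_zero_left (F : Type u) [Field F] (j : ZMod 2) : koszulSign F 0 j = 1 := by
  simp [koszulSign]

theorem koszulSign_one_one (F : Type u) [Field F] : koszulSign F 1 1 = -1 := by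
  have h : (1 : ZMod 2).val * (1 : ZMod 2).val = 1 := rfl
  rw [koszulSign, h, pow_one]

/-- A Lie superalgebra over `F`: a superspace `L = L₀ ⊕ L₁` with a bilinear bracket satisfying
the grading condition, graded skew-symmetry and the graded Jacobi identity. -/
class LieSuperalgebra (F : Type u) (L : Type v) [Field F] [AddCommGroup L] [Module F L] where
  /-- `part 0` is the even part and `part 1` is the odd part. -/
  part : ZMod 2 → Submodule F L
  isCompl : IsCompl (part 0) (part 1)
  bracket : L →ₗ[F] L →ₗ[F] L
  bracket_mem : ∀ i j : ZMod 2, ∀ x ∈ part i, ∀ y ∈ part j, bracket x y ∈ part (i + j)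
  skew : ∀ i j : ZMod 2, ∀ x ∈ part i, ∀ y ∈ part j,
    bracket x y = -(koszulSign F i j • bracket y x)
  jacobi : ∀ i j k : ZMod 2, ∀ x ∈ part i, ∀ y ∈ part j, ∀ z ∈ part k,
    koszulSign F i k • bracket x (bracket y z) + koszulSign F j i • bracket y (bracket z x)
      + koszulSign F k j • bracket z (bracket x y) = 0

namespace LieSuperalgebra

section Basic

variable (F : Type u) (L : Type v) [Field F] [AddCommGroup L] [Module F L] [LieSuperalgebra F L]

variable {L} in
/-- `[U, V]`: the span of all brackets `[x, y]` with `x ∈ U`, `y ∈ V`. -/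
def commutator (U V : Submodule F L) : Submodule F L :=
  Submodule.map₂ (bracket (F := F) (L := L)) U V

/-- The derived subalgebra `L' = [L, L]`. -/
def derived : Submodule F L := commutator F ⊤ ⊤

/-- The descending central sequence `C⁰(L) = L`, `Cᵏ⁺¹(L) = [Cᵏ(L), L]`. -/
def centralSeries : ℕ → Submodule F L
  | 0 => ⊤
  | k + 1 => commutator F (centralSeries k) ⊤

/-- `L` is nilpotent. -/
def IsNilpotent : Prop := ∃ k : ℕ, centralSeries F L k = ⊥

variable {L} in
/-- The superdimension `(dim U₀ | dim U₁)` of a (graded) subspace `U`. -/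
noncomputable def superdim (U : Submodule F L) : ℕ × ℕ :=
  (Module.finrank F ↥(U ⊓ part 0), Module.finrank F ↥(U ⊓ part 1))

end Basic

/-- A homomorphism of Lie superalgebras: an even linear map that preserves brackets. -/
structure Hom (F : Type u) (L : Type v) (M : Type w) [Field F]
    [AddCommGroup L] [Module F L] [LieSuperalgebra F L]
    [AddCommGroup M] [Module F M] [LieSuperalgebra F M] where
  toLinearMap : L →ₗ[F] M
  map_part : ∀ i : ZMod 2, ∀ x ∈ part (F := F) (L := L) i,
    toLinearMap x ∈ part (F := F) (L := M) i
  map_bracket : ∀ x y : L, toLinearMap (bracket (F := F) x y)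
    = bracket (F := F) (toLinearMap x) (toLinearMap y)

/-- `L` and `M` are isomorphic: there is a bijective homomorphism. -/
def IsIsomorphic (F : Type u) (L : Type v) (M : Type w) [Field F]
    [AddCommGroup L] [Module F L] [LieSuperalgebra F L]
    [AddCommGroup M] [Module F M] [LieSuperalgebra F M] : Prop :=
  ∃ f : Hom F L M, Function.Bijective f.toLinearMap

section Sum

/-- The direct sum `L ⊕ M`, graded and bracketed componentwise. -/
instance instProd (F : Type u) (L : Type v) (M : Type w) [Field F]
    [AddCommGroup L] [Module F L] [LieSuperalgebra F L]
    [AddCommGroup M] [Module F M] [LieSuperalgebra F M] : LieSuperalgebra F (L × M) where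
  part i := (part i).prod (part i)
  isCompl := by
    have hL := LieSuperalgebra.isCompl (F := F) (L := L)
    have hM := LieSuperalgebra.isCompl (F := F) (L := M)
    constructor
    · rw [disjoint_iff, Submodule.prod_inf_prod, hL.inf_eq_bot, hM.inf_eq_bot, Submodule.prod_bot]
    · rw [codisjoint_iff, Submodule.prod_sup_prod, hL.sup_eq_top, hM.sup_eq_top,
        Submodule.prod_top]
  bracket := LinearMap.mk₂ F (fun x y => (bracket (F := F) x.1 y.1, bracket (F := F) x.2 y.2))
    (by intros; simp) (by intros; simp) (by intros; simp) (by intros; simp)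
  bracket_mem i j x hx y hy :=
    ⟨bracket_mem i j _ hx.1 _ hy.1, bracket_mem i j _ hx.2 _ hy.2⟩
  skew i j x hx y hy :=
    Prod.ext (skew i j _ hx.1 _ hy.1) (skew i j _ hx.2 _ hy.2)
  jacobi i j k x hx y hy z hz :=
    Prod.ext (jacobi i j k _ hx.1 _ hy.1 _ hz.1) (jacobi i j k _ hx.2 _ hy.2 _ hz.2)

end Sum

/-- The standard grading of `V × W`: even part `V × 0`, odd part `0 × W`. -/
def stdPart (F : Type u) (V : Type v) (W : Type w) [Field F] [AddCommGroup V] [Module F V]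
    [AddCommGroup W] [Module F W] (i : ZMod 2) : Submodule F (V × W) :=
  if i = 0 then Submodule.prod ⊤ ⊥ else Submodule.prod ⊥ ⊤

theorem isCompl_stdPart (F : Type u) (V : Type v) (W : Type w) [Field F] [AddCommGroup V]
    [Module F V] [AddCommGroup W] [Module F W] :
    IsCompl (stdPart F V W 0) (stdPart F V W 1) := by
  constructor
  · rw [disjoint_iff]; simp [stdPart, Submodule.prod_inf_prod]
  · rw [codisjoint_iff]; simp [stdPart, Submodule.prod_sup_prod]

section Abelian

/-- The underlying space of the abelian Lie superalgebra `A(a | b)`. -/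
def Abelian (F : Type u) (a b : ℕ) : Type u := (Fin a → F) × (Fin b → F)

variable (F : Type u) [Field F] (a b : ℕ)

instance : AddCommGroup (Abelian F a b) :=
  inferInstanceAs (AddCommGroup ((Fin a → F) × (Fin b → F)))

instance : Module F (Abelian F a b) :=
  inferInstanceAs (Module F ((Fin a → F) × (Fin b → F)))

/-- The abelian Lie superalgebra `A(a | b)` of superdimension `(a | b)`. -/
instance instAbelian : LieSuperalgebra F (Abelian F a b) where
  part := stdPart F (Fin a → F) (Fin b → F)
  isCompl := isCompl_stdPart F _ _
  bracket := 0
  bracket_mem := by intros; exact Submodule.zero_mem _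
  skew := by intros; simp
  jacobi := by intros; simp

end Abelian

section Heisenberg

/-- The underlying space of the Heisenberg Lie superalgebra `H(m, n)`: the element
`((a, b, c), y)` stands for `∑ aᵢ xᵢ + ∑ bᵢ xₘ₊ᵢ + c z + ∑ yⱼ yⱼ`. -/
def Heisenberg (F : Type u) (m n : ℕ) : Type u :=
  ((Fin m → F) × (Fin m → F) × F) × (Fin n → F)

variable (F : Type u) [Field F] (m n : ℕ)

instance : AddCommGroup (Heisenberg F m n) :=
  inferInstanceAs (AddCommGroup (((Fin m → F) × (Fin m → F) × F) × (Fin n → F)))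

instance : Module F (Heisenberg F m n) :=
  inferInstanceAs (Module F (((Fin m → F) × (Fin m → F) × F) × (Fin n → F)))

/-- The bracket of `H(m, n)`: `[xᵢ, xₘ₊ᵢ] = z = -[xₘ₊ᵢ, xᵢ]`, `[yⱼ, yⱼ] = z`, and all other
brackets of basis elements vanish. -/
def heisenbergBracket :
    Heisenberg F m n →ₗ[F] Heisenberg F m n →ₗ[F] Heisenberg F m n :=
  LinearMap.mk₂ F (fun p q =>
      ((0, 0, p.1.1 ⬝ᵥ q.1.2.1 - p.1.2.1 ⬝ᵥ q.1.1 + p.2 ⬝ᵥ q.2), 0))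
    (by
      intro p p' q
      refine Prod.ext (Prod.ext (add_zero _).symm (Prod.ext (add_zero _).symm ?_))
        (add_zero _).symm
      change (p.1.1 + p'.1.1) ⬝ᵥ q.1.2.1 - (p.1.2.1 + p'.1.2.1) ⬝ᵥ q.1.1
        + (p.2 + p'.2) ⬝ᵥ q.2 = (p.1.1 ⬝ᵥ q.1.2.1 - p.1.2.1 ⬝ᵥ q.1.1 + p.2 ⬝ᵥ q.2)
        + (p'.1.1 ⬝ᵥ q.1.2.1 - p'.1.2.1 ⬝ᵥ q.1.1 + p'.2 ⬝ᵥ q.2)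
      simp only [add_dotProduct]; ring)
    (by
      intro t p q
      refine Prod.ext (Prod.ext (smul_zero _).symm (Prod.ext (smul_zero _).symm ?_))
        (smul_zero _).symm
      change (t • p.1.1) ⬝ᵥ q.1.2.1 - (t • p.1.2.1) ⬝ᵥ q.1.1 + (t • p.2) ⬝ᵥ q.2
        = t * (p.1.1 ⬝ᵥ q.1.2.1 - p.1.2.1 ⬝ᵥ q.1.1 + p.2 ⬝ᵥ q.2)
      simp only [smul_dotProduct, smul_eq_mul]; ring)
    (by
      intro p q q'
      refine Prod.ext (Prod.ext (add_zero _).symm (Prod.ext (add_zero _).symm ?_))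
        (add_zero _).symm
      change p.1.1 ⬝ᵥ (q.1.2.1 + q'.1.2.1) - p.1.2.1 ⬝ᵥ (q.1.1 + q'.1.1)
        + p.2 ⬝ᵥ (q.2 + q'.2) = (p.1.1 ⬝ᵥ q.1.2.1 - p.1.2.1 ⬝ᵥ q.1.1 + p.2 ⬝ᵥ q.2)
        + (p.1.1 ⬝ᵥ q'.1.2.1 - p.1.2.1 ⬝ᵥ q'.1.1 + p.2 ⬝ᵥ q'.2)
      simp only [dotProduct_add]; ring)
    (by
      intro t p q
      refine Prod.ext (Prod.ext (smul_zero _).symm (Prod.ext (smul_zero _).symm ?_))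
        (smul_zero _).symm
      change p.1.1 ⬝ᵥ (t • q.1.2.1) - p.1.2.1 ⬝ᵥ (t • q.1.1) + p.2 ⬝ᵥ (t • q.2)
        = t * (p.1.1 ⬝ᵥ q.1.2.1 - p.1.2.1 ⬝ᵥ q.1.1 + p.2 ⬝ᵥ q.2)
      simp only [dotProduct_smul, smul_eq_mul]; ring)

theorem heisenbergBracket_apply (p q : Heisenberg F m n) : heisenbergBracket F m n p q =
    ((0, 0, p.1.1 ⬝ᵥ q.1.2.1 - p.1.2.1 ⬝ᵥ q.1.1 + p.2 ⬝ᵥ q.2), 0) := rfl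

theorem heisenbergBracket_heisenbergBracket (p q r : Heisenberg F m n) :
    heisenbergBracket F m n p (heisenbergBracket F m n q r) = 0 := by
  rw [heisenbergBracket_apply F m n p]
  refine Prod.ext (Prod.ext rfl (Prod.ext rfl ?_)) rfl
  change p.1.1 ⬝ᵥ 0 - p.1.2.1 ⬝ᵥ 0 + p.2 ⬝ᵥ 0 = 0
  simp

/-- The Heisenberg Lie superalgebra `H(m, n)` with even centre, of superdimension
`(2m + 1 | n)`. -/
instance instHeisenberg : LieSuperalgebra F (Heisenberg F m n) where
  part := stdPart F ((Fin m → F) × (Fin m → F) × F) (Fin n → F)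
  isCompl := isCompl_stdPart F _ _
  bracket := heisenbergBracket F m n
  bracket_mem i j p hp q hq := by
    rw [heisenbergBracket_apply]
    fin_cases i <;> fin_cases j
    · exact ⟨trivial, rfl⟩
    · obtain ⟨-, hp : p.2 = 0⟩ := hp
      obtain ⟨hq : q.1 = 0, -⟩ := hq
      refine ⟨?_, trivial⟩
      simp [hp, hq]
    · obtain ⟨-, hq : q.2 = 0⟩ := hq
      obtain ⟨hp : p.1 = 0, -⟩ := hp
      refine ⟨?_, trivial⟩
      simp [hp, hq]
    · exact ⟨trivial, rfl⟩
  skew i j p hp q hq := by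
    rw [heisenbergBracket_apply, heisenbergBracket_apply]
    refine Prod.ext (Prod.ext ?_ (Prod.ext ?_ ?_)) ?_
    · exact (neg_eq_zero.2 (smul_zero _)).symm
    · exact (neg_eq_zero.2 (smul_zero _)).symm
    · change _ = -(koszulSign F i j * _)
      rw [dotProduct_comm q.1.1, dotProduct_comm q.1.2.1, dotProduct_comm q.2]
      obtain rfl | rfl := ZMod.eq_zero_or_one_of_two i <;>
        obtain rfl | rfl := ZMod.eq_zero_or_one_of_two j
      · obtain ⟨-, hp : p.2 = 0⟩ := hp
        simp [koszulSign_zero_left, hp]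
      · obtain ⟨-, hp : p.2 = 0⟩ := hp
        obtain ⟨hq : q.1 = 0, -⟩ := hq
        simp [hp, hq]
      · obtain ⟨-, hq : q.2 = 0⟩ := hq
        obtain ⟨hp : p.1 = 0, -⟩ := hp
        simp [hp, hq]
      · obtain ⟨hp : p.1 = 0, -⟩ := hp
        simp [koszulSign_one_one, hp]
    · exact (neg_eq_zero.2 (smul_zero _)).symm
  jacobi i j k p _ q _ r _ := by
    simp [heisenbergBracket_heisenbergBracket]

end Heisenberg

section Free

variable (F : Type u) [Field F] {X : Type w} (deg : X → ZMod 2)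

/-- The degree of a nonassociative word in the generators. -/
def wordDeg : FreeMagma X → ZMod 2
  | .of x => deg x
  | .mul a b => wordDeg a + wordDeg b

/-- A word, as an element of the free nonassociative algebra. -/
noncomputable def word (a : FreeMagma X) : FreeNonUnitalNonAssocAlgebra F X :=
  MonoidAlgebra.single a 1

/-- The elements of the free nonassociative algebra that are made to vanish: graded
skew-symmetry and graded Jacobi for all words, and all their multiples by words. -/
inductive IsRelator : FreeNonUnitalNonAssocAlgebra F X → Prop
  | skew (a b : FreeMagma X) : IsRelator
      (word F a * word F b + koszulSign F (wordDeg deg a) (wordDeg deg b) • (word F b * word F a))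
  | jacobi (a b c : FreeMagma X) : IsRelator
      (koszulSign F (wordDeg deg a) (wordDeg deg c) • (word F a * (word F b * word F c))
        + koszulSign F (wordDeg deg b) (wordDeg deg a) • (word F b * (word F c * word F a))
        + koszulSign F (wordDeg deg c) (wordDeg deg b) • (word F c * (word F a * word F b)))
  | mul_left (a : FreeMagma X) (r : FreeNonUnitalNonAssocAlgebra F X) :
      IsRelator r → IsRelator (word F a * r)
  | mul_right (a : FreeMagma X) (r : FreeNonUnitalNonAssocAlgebra F X) :
      IsRelator r → IsRelator (r * word F a)

/-- The two-sided ideal of relations. -/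
noncomputable def relations : Submodule F (FreeNonUnitalNonAssocAlgebra F X) :=
  Submodule.span F {r | IsRelator F deg r}

/-- The free Lie superalgebra on the `ZMod 2`-graded set `(X, deg)`. -/
def Free : Type (max u w) := FreeNonUnitalNonAssocAlgebra F X ⧸ relations F deg

noncomputable instance : AddCommGroup (Free F deg) :=
  inferInstanceAs (AddCommGroup (FreeNonUnitalNonAssocAlgebra F X ⧸ relations F deg))

noncomputable instance : Module F (Free F deg) :=
  inferInstanceAs (Module F (FreeNonUnitalNonAssocAlgebra F X ⧸ relations F deg))

/-- The quotient map from the free nonassociative algebra. -/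
noncomputable def Free.mk : FreeNonUnitalNonAssocAlgebra F X →ₗ[F] Free F deg :=
  (relations F deg).mkQ

theorem Free.mk_surjective : Function.Surjective (Free.mk F deg) :=
  (relations F deg).mkQ_surjective

theorem Free.mk_eq_zero {r : FreeNonUnitalNonAssocAlgebra F X} :
    Free.mk F deg r = 0 ↔ r ∈ relations F deg :=
  Submodule.Quotient.mk_eq_zero _

/-- The generators of the free Lie superalgebra. -/
noncomputable def Free.of (x : X) : Free F deg := Free.mk F deg (word F (FreeMagma.of x))

/-- The span of the words of degree `i`. -/
noncomputable def wordPart (i : ZMod 2) : Submodule F (FreeNonUnitalNonAssocAlgebra F X) :=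
  Submodule.span F (word F '' {a | wordDeg deg a = i})

theorem word_mul_word (a b : FreeMagma X) : word F a * word F b = word F (a * b) := by
  simp [word, MonoidAlgebra.single_mul_single]

theorem wordDeg_mul (a b : FreeMagma X) :
    wordDeg deg (a * b) = wordDeg deg a + wordDeg deg b := rfl

theorem span_word : Submodule.span F (Set.range (word F (X := X))) = ⊤ := by
  rw [eq_top_iff]
  rintro x -
  induction x using MonoidAlgebra.induction_linear with
  | zero => exact Submodule.zero_mem _
  | add x y hx hy => exact Submodule.add_mem _ hx hy
  | single a t =>
    have : (MonoidAlgebra.single a t : FreeNonUnitalNonAssocAlgebra F X) = t • word F a := by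
      simp [word]
    rw [this]
    exact Submodule.smul_mem _ _ (Submodule.subset_span ⟨a, rfl⟩)

theorem word_mem_wordPart (a : FreeMagma X) : word F a ∈ wordPart F deg (wordDeg deg a) :=
  Submodule.subset_span ⟨a, rfl, rfl⟩

theorem mul_mem_wordPart {i j : ZMod 2} {x y : FreeNonUnitalNonAssocAlgebra F X}
    (hx : x ∈ wordPart F deg i) (hy : y ∈ wordPart F deg j) : x * y ∈ wordPart F deg (i + j) := by
  have : Submodule.map₂ (LinearMap.mul F (FreeNonUnitalNonAssocAlgebra F X))
      (wordPart F deg i) (wordPart F deg j) ≤ wordPart F deg (i + j) := by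
    rw [wordPart, wordPart, Submodule.map₂_span_span, Submodule.span_le]
    rintro _ ⟨_, ⟨a, rfl, rfl⟩, _, ⟨b, rfl, rfl⟩, rfl⟩
    simp only [LinearMap.mul_apply', word_mul_word, SetLike.mem_coe]
    exact word_mem_wordPart F deg (a * b)
  exact this (Submodule.apply_mem_map₂ _ hx hy)

theorem wordPart_sup : wordPart F deg 0 ⊔ wordPart F deg 1 = ⊤ := by
  rw [eq_top_iff, ← span_word, Submodule.span_le]
  rintro _ ⟨a, rfl⟩
  have h := word_mem_wordPart F deg a
  generalize wordDeg deg a = i at h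
  fin_cases i
  · exact Submodule.mem_sup_left h
  · exact Submodule.mem_sup_right h

/-- The projection onto the span of the words of degree `i`. -/
noncomputable def wordProj (i : ZMod 2) :
    FreeNonUnitalNonAssocAlgebra F X →ₗ[F] FreeNonUnitalNonAssocAlgebra F X :=
  (Finsupp.linearCombination F (fun a => if wordDeg deg a = i then word F a else 0)).comp
    (MonoidAlgebra.coeffLinearEquiv F).toLinearMap

theorem wordProj_word (i : ZMod 2) (a : FreeMagma X) :
    wordProj F deg i (word F a) = if wordDeg deg a = i then word F a else 0 := by
  simp [wordProj, word]

theorem wordProj_of_mem {i j : ZMod 2} {x : FreeNonUnitalNonAssocAlgebra F X}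
    (hx : x ∈ wordPart F deg j) : wordProj F deg i x = if j = i then x else 0 := by
  induction hx using Submodule.span_induction with
  | mem x h =>
    obtain ⟨a, rfl, rfl⟩ := h
    exact wordProj_word F deg i a
  | zero => simp
  | add x y _ _ hx hy => rw [map_add, hx, hy]; split_ifs <;> simp
  | smul t x _ hx => rw [map_smul, hx]; split_ifs <;> simp

theorem IsRelator.exists_mem {r : FreeNonUnitalNonAssocAlgebra F X} (hr : IsRelator F deg r) :
    ∃ i, r ∈ wordPart F deg i := by
  have hw := word_mem_wordPart F deg
  induction hr with
  | skew a b =>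
    refine ⟨wordDeg deg a + wordDeg deg b, Submodule.add_mem _ ?_ (Submodule.smul_mem _ _ ?_)⟩
    · exact mul_mem_wordPart F deg (hw a) (hw b)
    · rw [add_comm]; exact mul_mem_wordPart F deg (hw b) (hw a)
  | jacobi a b c =>
    refine ⟨wordDeg deg a + (wordDeg deg b + wordDeg deg c), Submodule.add_mem _
      (Submodule.add_mem _ (Submodule.smul_mem _ _ ?_) (Submodule.smul_mem _ _ ?_))
      (Submodule.smul_mem _ _ ?_)⟩
    · exact mul_mem_wordPart F deg (hw a) (mul_mem_wordPart F deg (hw b) (hw c))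
    · have : wordDeg deg a + (wordDeg deg b + wordDeg deg c)
          = wordDeg deg b + (wordDeg deg c + wordDeg deg a) := by ring
      rw [this]
      exact mul_mem_wordPart F deg (hw b) (mul_mem_wordPart F deg (hw c) (hw a))
    · have : wordDeg deg a + (wordDeg deg b + wordDeg deg c)
          = wordDeg deg c + (wordDeg deg a + wordDeg deg b) := by ring
      rw [this]
      exact mul_mem_wordPart F deg (hw c) (mul_mem_wordPart F deg (hw a) (hw b))
  | mul_left a r _ ih =>
    obtain ⟨i, hi⟩ := ih
    exact ⟨_, mul_mem_wordPart F deg (hw a) hi⟩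
  | mul_right a r _ ih =>
    obtain ⟨i, hi⟩ := ih
    exact ⟨_, mul_mem_wordPart F deg hi (hw a)⟩

theorem wordProj_mem_relations (i : ZMod 2) {r : FreeNonUnitalNonAssocAlgebra F X}
    (hr : r ∈ relations F deg) : wordProj F deg i r ∈ relations F deg := by
  induction hr using Submodule.span_induction with
  | mem r hr =>
    obtain ⟨j, hj⟩ := IsRelator.exists_mem F deg hr
    rw [wordProj_of_mem F deg hj]
    split_ifs
    · exact Submodule.subset_span hr
    · exact Submodule.zero_mem _
  | zero => simp
  | add x y _ _ hx hy => rw [map_add]; exact Submodule.add_mem _ hx hy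
  | smul t x _ hx => rw [map_smul]; exact Submodule.smul_mem _ _ hx

theorem mul_mem_relations (x : FreeNonUnitalNonAssocAlgebra F X)
    {r : FreeNonUnitalNonAssocAlgebra F X} (hr : r ∈ relations F deg) :
    x * r ∈ relations F deg := by
  have : Submodule.map₂ (LinearMap.mul F (FreeNonUnitalNonAssocAlgebra F X)) ⊤
      (relations F deg) ≤ relations F deg := by
    rw [← span_word, relations, Submodule.map₂_span_span, Submodule.span_le]
    rintro _ ⟨_, ⟨a, rfl⟩, r, hr, rfl⟩
    exact Submodule.subset_span (IsRelator.mul_left a r hr)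
  exact this (Submodule.apply_mem_map₂ _ trivial hr)

theorem mul_mem_relations_right (x : FreeNonUnitalNonAssocAlgebra F X)
    {r : FreeNonUnitalNonAssocAlgebra F X} (hr : r ∈ relations F deg) :
    r * x ∈ relations F deg := by
  have : Submodule.map₂ (LinearMap.mul F (FreeNonUnitalNonAssocAlgebra F X))
      (relations F deg) ⊤ ≤ relations F deg := by
    rw [← span_word, relations, Submodule.map₂_span_span, Submodule.span_le]
    rintro _ ⟨r, hr, _, ⟨a, rfl⟩, rfl⟩
    exact Submodule.subset_span (IsRelator.mul_right a r hr)
  exact this (Submodule.apply_mem_map₂ _ hr trivial)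

/-- The bracket of the free Lie superalgebra, induced by the product of words. -/
noncomputable def freeBracket : Free F deg →ₗ[F] Free F deg →ₗ[F] Free F deg :=
  (relations F deg).liftQ
    (((relations F deg).liftQ
      ((LinearMap.mul F (FreeNonUnitalNonAssocAlgebra F X)).compr₂ (Free.mk F deg)).flip
      (by
        intro r hr
        refine LinearMap.ext fun x => ?_
        exact (Free.mk_eq_zero F deg).2 (mul_mem_relations F deg x hr))).flip)
    (by
      intro r hr
      refine LinearMap.ext fun y => ?_
      obtain ⟨y, rfl⟩ := Free.mk_surjective F deg y
      exact (Free.mk_eq_zero F deg).2 (mul_mem_relations_right F deg y hr))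

theorem freeBracket_mk (x y : FreeNonUnitalNonAssocAlgebra F X) :
    freeBracket F deg (Free.mk F deg x) (Free.mk F deg y) = Free.mk F deg (x * y) := rfl

/-- The graded components of the free Lie superalgebra. -/
noncomputable def freePart (i : ZMod 2) : Submodule F (Free F deg) :=
  (wordPart F deg i).map (Free.mk F deg)

theorem freePart_eq_span (i : ZMod 2) : freePart F deg i =
    Submodule.span F ((fun a => Free.mk F deg (word F a)) '' {a | wordDeg deg a = i}) := by
  rw [freePart, wordPart, Submodule.map_span, Set.image_image]

/-- The free Lie superalgebra. -/
noncomputable instance instFree : LieSuperalgebra F (Free F deg) where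
  part := freePart F deg
  isCompl := by
    constructor
    · rw [Submodule.disjoint_def]
      rintro _ ⟨x, hx, rfl⟩ ⟨y, hy, hxy⟩
      have h : x - y ∈ relations F deg := by
        rw [← Free.mk_eq_zero, map_sub, hxy, sub_self]
      have h0 := wordProj_mem_relations F deg 0 h
      rw [map_sub, wordProj_of_mem F deg hx, wordProj_of_mem F deg hy] at h0
      simpa [Free.mk_eq_zero] using h0
    · rw [codisjoint_iff, freePart, freePart, ← Submodule.map_sup, wordPart_sup,
        Submodule.map_top, LinearMap.range_eq_top]
      exact Free.mk_surjective F deg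
  bracket := freeBracket F deg
  bracket_mem := by
    rintro i j _ ⟨x, hx, rfl⟩ _ ⟨y, hy, rfl⟩
    exact ⟨x * y, mul_mem_wordPart F deg hx hy, rfl⟩
  skew := by
    intro i j x hx y hy
    rw [freePart_eq_span] at hx hy
    induction hx, hy using Submodule.span_induction₂ with
    | mem_mem x y hx hy =>
      obtain ⟨a, rfl, rfl⟩ := hx
      obtain ⟨b, rfl, rfl⟩ := hy
      rw [eq_neg_iff_add_eq_zero]
      exact (Free.mk_eq_zero F deg).2 (Submodule.subset_span (IsRelator.skew a b))
    | zero_left y hy => simp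
    | zero_right x hx => simp
    | add_left x y z _ _ _ hx hy =>
      simp only [map_add, LinearMap.add_apply, smul_add, neg_add, hx, hy]
    | add_right x y z _ _ _ hx hy =>
      simp only [map_add, LinearMap.add_apply, smul_add, neg_add, hx, hy]
    | smul_left t x y _ _ h =>
      simp only [map_smul, LinearMap.smul_apply, h, smul_neg]
      rw [smul_comm]
    | smul_right t x y _ _ h =>
      simp only [map_smul, LinearMap.smul_apply, h, smul_neg]
      rw [smul_comm]
  jacobi := by
    intro i j k x hx y hy z hz
    rw [freePart_eq_span] at hx hy hz
    induction hx using Submodule.span_induction with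
    | zero => simp
    | add x x' _ _ hx hx' =>
      simp only [map_add, LinearMap.add_apply, smul_add]
      have := congrArg₂ (· + ·) hx hx'
      simp only [add_zero] at this
      rw [← this]; abel
    | smul t x _ hx =>
      have := congrArg (t • ·) hx
      simp only [smul_zero, smul_add] at this
      simp only [map_smul, LinearMap.smul_apply]
      rw [← this, smul_comm _ t, smul_comm _ t, smul_comm _ t]
    | mem x hx =>
    induction hy, hz using Submodule.span_induction₂ with
    | mem_mem y z hy hz =>
      obtain ⟨a, rfl, rfl⟩ := hx
      obtain ⟨b, rfl, rfl⟩ := hy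
      obtain ⟨c, rfl, rfl⟩ := hz
      exact (Free.mk_eq_zero F deg).2 (Submodule.subset_span (IsRelator.jacobi a b c))
    | zero_left y hy => simp
    | zero_right x hx => simp
    | add_left y y' z _ _ _ hx hx' =>
      simp only [map_add, LinearMap.add_apply, smul_add]
      have := congrArg₂ (· + ·) hx hx'
      simp only [add_zero] at this
      rw [← this]; abel
    | add_right y z z' _ _ _ hx hx' =>
      simp only [map_add, LinearMap.add_apply, smul_add]
      have := congrArg₂ (· + ·) hx hx'
      simp only [add_zero] at this
      rw [← this]; abel
    | smul_left t y z _ _ h =>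
      have := congrArg (t • ·) h
      simp only [smul_zero, smul_add] at this
      simp only [map_smul, LinearMap.smul_apply]
      rw [← this, smul_comm _ t, smul_comm _ t, smul_comm _ t]
    | smul_right t y z _ _ h =>
      have := congrArg (t • ·) h
      simp only [smul_zero, smul_add] at this
      simp only [map_smul, LinearMap.smul_apply]
      rw [← this, smul_comm _ t, smul_comm _ t, smul_comm _ t]

variable {M : Type v} [AddCommGroup M] [Module F M] [LieSuperalgebra F M]

/-- Evaluation of a nonassociative word in a Lie superalgebra. -/
def wordEval (φ : X → M) : FreeMagma X → M
  | .of x => φ x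
  | .mul a b => bracket (F := F) (wordEval φ a) (wordEval φ b)

theorem wordEval_mem {φ : X → M} (hφ : ∀ x, φ x ∈ part (F := F) (L := M) (deg x))
    (a : FreeMagma X) : wordEval F φ a ∈ part (F := F) (L := M) (wordDeg deg a) := by
  induction a with
  | ih1 x => exact hφ x
  | ih2 a b ha hb => exact bracket_mem _ _ _ ha _ hb

/-- The linear extension of `wordEval`. -/
noncomputable def evalMap (φ : X → M) : FreeNonUnitalNonAssocAlgebra F X →ₗ[F] M :=
  (Finsupp.linearCombination F (wordEval F φ)).comp
    (MonoidAlgebra.coeffLinearEquiv F).toLinearMap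

theorem evalMap_word (φ : X → M) (a : FreeMagma X) :
    evalMap F φ (word F a) = wordEval F φ a := by
  simp [evalMap, word]

theorem evalMap_mul (φ : X → M) (x y : FreeNonUnitalNonAssocAlgebra F X) :
    evalMap F φ (x * y) = bracket (F := F) (evalMap F φ x) (evalMap F φ y) := by
  have hx : x ∈ Submodule.span F (Set.range (word F (X := X))) := by rw [span_word]; trivial
  have hy : y ∈ Submodule.span F (Set.range (word F (X := X))) := by rw [span_word]; trivial
  induction hx, hy using Submodule.span_induction₂ with
  | mem_mem x y hx hy =>
    obtain ⟨a, rfl⟩ := hx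
    obtain ⟨b, rfl⟩ := hy
    rw [word_mul_word, evalMap_word, evalMap_word, evalMap_word]
    rfl
  | zero_left y hy => simp
  | zero_right x hx => simp
  | add_left x y z _ _ _ hx hy => simp only [add_mul, map_add, LinearMap.add_apply, hx, hy]
  | add_right x y z _ _ _ hx hy => simp only [mul_add, map_add, hx, hy]
  | smul_left t x y _ _ h => simp only [smul_mul_assoc, map_smul, LinearMap.smul_apply, h]
  | smul_right t x y _ _ h => simp only [mul_smul_comm, map_smul, h]

theorem relations_le_ker {φ : X → M} (hφ : ∀ x, φ x ∈ part (F := F) (L := M) (deg x)) :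
    relations F deg ≤ LinearMap.ker (evalMap F φ) := by
  rw [relations, Submodule.span_le]
  intro r hr
  have h := wordEval_mem F deg hφ
  change evalMap F φ r = 0
  induction hr with
  | skew a b =>
    simp only [map_add, map_smul, evalMap_mul, evalMap_word]
    rw [← eq_neg_iff_add_eq_zero]
    exact LieSuperalgebra.skew _ _ _ (h a) _ (h b)
  | jacobi a b c =>
    simp only [map_add, map_smul, evalMap_mul, evalMap_word]
    exact LieSuperalgebra.jacobi _ _ _ _ (h a) _ (h b) _ (h c)
  | mul_left a r _ ih => rw [evalMap_mul, ih, map_zero]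
  | mul_right a r _ ih => rw [evalMap_mul, ih, map_zero, LinearMap.zero_apply]

/-- The universal property of the free Lie superalgebra: a degree-preserving map from the
generators to a Lie superalgebra extends uniquely to a homomorphism. -/
theorem Free.existsUnique_hom {φ : X → M} (hφ : ∀ x, φ x ∈ part (F := F) (L := M) (deg x)) :
    ∃! f : Hom F (Free F deg) M, ∀ x, f.toLinearMap (Free.of F deg x) = φ x := by
  refine ⟨⟨(relations F deg).liftQ (evalMap F φ) (relations_le_ker F deg hφ), ?_, ?_⟩, ?_, ?_⟩
  · rintro i _ ⟨x, hx, rfl⟩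
    change evalMap F φ x ∈ _
    induction hx using Submodule.span_induction with
    | mem x hx =>
      obtain ⟨a, rfl, rfl⟩ := hx
      rw [evalMap_word]
      exact wordEval_mem F deg hφ a
    | zero => simp
    | add x y _ _ hx hy => rw [map_add]; exact Submodule.add_mem _ hx hy
    | smul t x _ hx => rw [map_smul]; exact Submodule.smul_mem _ _ hx
  · intro x y
    obtain ⟨x, rfl⟩ := Free.mk_surjective F deg x
    obtain ⟨y, rfl⟩ := Free.mk_surjective F deg y
    exact evalMap_mul F φ x y
  · intro x
    exact evalMap_word F φ _
  · rintro ⟨g, hg, hg'⟩ hgφ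
    congr 1
    refine LinearMap.ext fun x => ?_
    obtain ⟨x, rfl⟩ := Free.mk_surjective F deg x
    change g (Free.mk F deg x) = evalMap F φ x
    have hx : x ∈ Submodule.span F (Set.range (word F (X := X))) := by rw [span_word]; trivial
    induction hx using Submodule.span_induction with
    | mem x hx =>
      obtain ⟨a, rfl⟩ := hx
      rw [evalMap_word]
      induction a with
      | ih1 x => exact hgφ x
      | ih2 a b ha hb =>
        have h : Free.mk F deg (word F (a * b)) = bracket (F := F) (Free.mk F deg (word F a))
            (Free.mk F deg (word F b)) := by
          change _ = Free.mk F deg (word F a * word F b)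
          rw [word_mul_word]
        rw [h, hg', ha, hb]
        rfl
    | zero => simp
    | add x y _ _ hx hy => simp only [map_add, hx, hy]
    | smul t x _ hx => simp only [map_smul, hx]

variable (M) in
/-- Every Lie superalgebra has a free presentation. -/
theorem exists_freePresentation : ∃ (X : Type v) (deg : X → ZMod 2)
    (ψ : Hom F (Free F deg) M), Function.Surjective ψ.toLinearMap := by
  obtain ⟨ψ, hψ, -⟩ := Free.existsUnique_hom F
    (X := Σ i : ZMod 2, ↥(part (F := F) (L := M) i)) (fun x => x.1)
    (φ := fun x => (x.2 : M)) (fun x => x.2.2)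
  refine ⟨_, _, ψ, ?_⟩
  rw [← LinearMap.range_eq_top, eq_top_iff, ← (isCompl (F := F) (L := M)).sup_eq_top, sup_le_iff]
  exact ⟨fun y hy => ⟨_, hψ ⟨0, y, hy⟩⟩, fun y hy => ⟨_, hψ ⟨1, y, hy⟩⟩⟩

end Free

section Multiplier

variable {F : Type u} {L : Type v} [Field F] [AddCommGroup L] [Module F L] [LieSuperalgebra F L]
  {X : Type w} {deg : X → ZMod 2}

/-- The multiplier `([𝓕, 𝓕] ∩ R) / [𝓕, R]` computed from a homomorphism `ψ : 𝓕 → L` on a free Lie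
superalgebra `𝓕`, where `R = ker ψ`. If `ψ` is surjective, that is, if `0 → R → 𝓕 → L → 0` is a
free presentation of `L`, then this is the multiplier `M(L)` of `L`. -/
abbrev Multiplier (ψ : Hom F (Free F deg) L) : Type (max u w) :=
  ↥(derived F (Free F deg) ⊓ LinearMap.ker ψ.toLinearMap) ⧸
    (commutator F (⊤ : Submodule F (Free F deg)) (LinearMap.ker ψ.toLinearMap)).submoduleOf
      (derived F (Free F deg) ⊓ LinearMap.ker ψ.toLinearMap)

end Multiplier

end LieSuperalgebra

namespace LieSuperalgebra

/-! Let `R = ker ψ`, and write g(U, V) for the span of the values of g on U × V. The bracket of the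
free algebra 𝓕, read modulo [𝓕, R], depends only on images in L. It therefore gives a bilinear map g
on L which is superskew and satisfies the cocycle identity. Its values span [𝓕, 𝓕]/[𝓕, R], and
rank-nullity for the map of this space onto L' gives dim M(L) + dim L' = dim g(L, L)
(`finrank_multiplier_add`). Everything reduces to estimating dim g(L, L).

Upper bound. Put p = m - r, q = n - s and choose L = S + L' with S spanned by p even and q odd
elements. Then g(L, L) = g(S, S) + g(L', L), and superskewness bounds dim g(S, S) by (p+q)(p+q-1)/2
+ q. For the second term, nilpotency supplies homogeneous y, w with [y, w] outside [L', L], and L' =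
K + ⟨[y, w]⟩ for a graded hyperplane K containing [L', L]. The Jacobi identity reduces g(L', L) to
g(K, L) and the two elements g(y, [y, w]), g(w, [y, w]) (`map₂_derived_le`). Nilpotency and Jacobi
again give g(K, L) = g(K, S) (`map₂_top_le`), of dimension at most (r+s-1)(p+q). The resulting bound
is better than the stated one by s.

Equality for r + s = 1. The slack s forces s = 0 and dim g(L', L) = 2, so g(y, [y, w]) and g(w, [y,
w]) are independent whenever y, w are homogeneous and [y, w] ≠ 0. This excludes nonzero squares of
odd elements, and through Jacobi it makes the orthogonal of y totally isotropic, so the bracket is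
an alternating form of rank two (`isIsomorphic_of_two_le_finrank`).

Conversely, every even cocycle on L factors through g, because it defines a central extension to
which ψ lifts (`finrank_map₂_le_of_free`). On H(1,0) ⊕ A(m-3|n), wedge products of coordinates
provide enough independent cocycles (`exists_isCocycle_of_coordinates`). -/

theorem finrank_map₂_le {F L W : Type*} [Field F] [AddCommGroup L] [Module F L]
    [AddCommGroup W] [Module F W] [FiniteDimensional F L]
    (g : L →ₗ[F] L →ₗ[F] W) (U V : Submodule F L) :
    Module.finrank F (Submodule.map₂ g U V) ≤ Module.finrank F U * Module.finrank F V := by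
  rw [TensorProduct.map₂_eq_range_lift_comp_mapIncl, ← Module.finrank_tensorProduct]
  exact LinearMap.finrank_range_le _

/-! ### Graded subspaces -/

section Graded

variable {F : Type u} {L : Type v} [Field F] [AddCommGroup L] [Module F L] [LieSuperalgebra F L]

theorem koszulSign_ne_zero (i j : ZMod 2) : koszulSign F i j ≠ 0 := by
  simp [koszulSign]

/-- A subspace is graded if it is the sum of its intersections with the two parts. -/
def IsGraded (U : Submodule F L) : Prop := U ≤ U ⊓ part 0 ⊔ U ⊓ part 1

theorem IsGraded.le {U V : Submodule F L} (hU : IsGraded U)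
    (h : ∀ i, ∀ x ∈ U, x ∈ part (F := F) i → x ∈ V) : U ≤ V :=
  hU.trans (sup_le (fun x hx => h 0 x hx.1 hx.2) (fun x hx => h 1 x hx.1 hx.2))

theorem inf_part_le (U : Submodule F L) (i : ZMod 2) : U ⊓ part i ≤ U ⊓ part 0 ⊔ U ⊓ part 1 := by
  obtain rfl | rfl := ZMod.eq_zero_or_one_of_two i
  · exact le_sup_left
  · exact le_sup_right

theorem isGraded_top : IsGraded (⊤ : Submodule F L) := by
  rw [IsGraded, top_inf_eq, top_inf_eq, isCompl.sup_eq_top]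

theorem exists_add_of_part (x : L) :
    ∃ a ∈ part (F := F) (L := L) 0, ∃ b ∈ part (F := F) (L := L) 1, a + b = x := by
  have hx : x ∈ part (F := F) (L := L) 0 ⊔ part 1 := by rw [isCompl.sup_eq_top]; trivial
  exact Submodule.mem_sup.1 hx

theorem eq_zero_of_mem_parts {x : L} (h0 : x ∈ part (F := F) (L := L) 0)
    (h1 : x ∈ part (F := F) (L := L) 1) : x = 0 :=
  Submodule.disjoint_def.1 (isCompl (F := F) (L := L)).disjoint x h0 h1

variable {W : Type*} [AddCommGroup W] [Module F W]

/-- Skew-symmetry and the cocycle identity are available only for homogeneous elements. Inclusions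
between spans of values are reduced to such elements here. -/
theorem map₂_le_of_isGraded {g : L →ₗ[F] L →ₗ[F] W} {U V : Submodule F L} (hU : IsGraded U)
    (hV : IsGraded V) {T : Submodule F W}
    (h : ∀ i j, ∀ x ∈ U, x ∈ part (F := F) i → ∀ y ∈ V, y ∈ part (F := F) j → g x y ∈ T) :
    Submodule.map₂ g U V ≤ T := by
  rw [Submodule.map₂_le]
  intro x hx y hy
  have h1 : U ≤ T.comap (g.flip y) := hU.le fun i x hx hxi => by
    have h2 : V ≤ T.comap (g x) := hV.le fun j y hy hyj => h i j x hx hxi y hy hyj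
    exact h2 hy
  exact h1 hx

theorem isGraded_commutator {U V : Submodule F L} (hU : IsGraded U) (hV : IsGraded V) :
    IsGraded (commutator F U V) :=
  map₂_le_of_isGraded hU hV fun i j _ hx hxi _ hy hyj =>
    inf_part_le _ (i + j) ⟨Submodule.apply_mem_map₂ _ hx hy, bracket_mem i j _ hxi _ hyj⟩

/-- The homogeneous components of an element are unique, so those found in U and those found in V
coincide. -/
theorem isGraded_inf {U V : Submodule F L} (hU : IsGraded U) (hV : IsGraded V) :
    IsGraded (U ⊓ V) := by
  rintro x ⟨hxU, hxV⟩
  obtain ⟨a, ha, b, hb, rfl⟩ := Submodule.mem_sup.1 (hU hxU)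
  obtain ⟨c, hc, d, hd, hcd⟩ := Submodule.mem_sup.1 (hV hxV)
  have hac : c = a := by
    refine sub_eq_zero.1 (eq_zero_of_mem_parts (F := F) (Submodule.sub_mem _ hc.2 ha.2) ?_)
    have : c - a = b - d := by rw [sub_eq_sub_iff_add_eq_add, hcd, add_comm]
    rw [this]
    exact Submodule.sub_mem _ hb.2 hd.2
  subst hac
  have hbd : d = b := add_left_cancel hcd
  subst hbd
  exact Submodule.add_mem_sup ⟨⟨ha.1, hc.1⟩, ha.2⟩ ⟨⟨hb.1, hd.1⟩, hb.2⟩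

theorem isGraded_centralSeries (k : ℕ) : IsGraded (centralSeries F L k) := by
  induction k with
  | zero => exact isGraded_top
  | succ k ih => exact isGraded_commutator ih isGraded_top

theorem isGraded_derived : IsGraded (derived F L) :=
  isGraded_commutator isGraded_top isGraded_top

theorem isGraded_ker {M : Type w} [AddCommGroup M] [Module F M] [LieSuperalgebra F M]
    (ψ : Hom F L M) : IsGraded (LinearMap.ker ψ.toLinearMap) := by
  intro x hx
  obtain ⟨a, ha, b, hb, rfl⟩ := exists_add_of_part (F := F) x
  have hab : ψ.toLinearMap a = -ψ.toLinearMap b := by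
    rw [LinearMap.mem_ker, map_add] at hx
    exact eq_neg_of_add_eq_zero_left hx
  have ha0 : ψ.toLinearMap a = 0 := by
    refine eq_zero_of_mem_parts (F := F) (ψ.map_part 0 a ha) ?_
    rw [hab]
    exact Submodule.neg_mem _ (ψ.map_part 1 b hb)
  have hb0 : ψ.toLinearMap b = 0 := by rwa [ha0, eq_comm, neg_eq_zero] at hab
  exact Submodule.add_mem_sup ⟨ha0, ha⟩ ⟨hb0, hb⟩

/-- A graded subspace of codimension one: the kernel, inside `D`, of a functional vanishing on
the graded subspace `C` but not on the homogeneous element `z`. -/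
theorem exists_isGraded_hyperplane [FiniteDimensional F L] {C D : Submodule F L}
    (hC : IsGraded C) (hD : IsGraded D) (hCD : C ≤ D) {i : ZMod 2} {z : L}
    (hz : z ∈ part (F := F) i) (hzD : z ∈ D) (hzC : z ∉ C) :
    ∃ K : Submodule F L, IsGraded K ∧ C ≤ K ∧ K ≤ D ∧ D ≤ K ⊔ Submodule.span F {z} ∧
      Module.finrank F K + 1 = Module.finrank F D := by
  obtain ⟨f, hfz, hfC⟩ := Submodule.exists_le_ker_of_notMem hzC
  -- The kernel of f need not be graded. Cutting only the component of degree i, where z lives,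
  -- keeps K graded; i + 1 is the other degree.
  let K : Submodule F L := D ⊓ part (i + 1) ⊔ D ⊓ part i ⊓ LinearMap.ker f
  have hi : ∀ j : ZMod 2, j = i ∨ j = i + 1 := by clear hz; revert i; decide
  have hKD : K ≤ D := sup_le inf_le_left (inf_le_left.trans inf_le_left)
  have hzK : z ∉ K := by
    intro hzK
    obtain ⟨a, ha, b, hb, rfl⟩ := Submodule.mem_sup.1 hzK
    have ha' : a ∈ part (F := F) i := by
      simpa using Submodule.sub_mem _ hz hb.1.2
    have ha0 : a = 0 := by
      obtain rfl | rfl := ZMod.eq_zero_or_one_of_two i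
      · exact eq_zero_of_mem_parts ha' ha.2
      · exact eq_zero_of_mem_parts ha.2 ha'
    rw [ha0, zero_add] at hfz
    exact hfz hb.2
  have hDK : D ≤ K ⊔ Submodule.span F {z} := by
    refine hD.le fun j x hx hxj => ?_
    obtain rfl | rfl := hi j
    · have h : x = (x - (f x / f z) • z) + (f x / f z) • z := by abel
      rw [h]
      refine Submodule.add_mem_sup (Submodule.mem_sup_right ⟨⟨?_, ?_⟩, ?_⟩)
        (Submodule.smul_mem _ _ (Submodule.mem_span_singleton_self z))
      · exact Submodule.sub_mem _ hx (Submodule.smul_mem _ _ hzD)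
      · exact Submodule.sub_mem _ hxj (Submodule.smul_mem _ _ hz)
      · change f _ = 0
        rw [map_sub, map_smul, smul_eq_mul, div_mul_cancel₀ _ hfz, sub_self]
    · exact Submodule.mem_sup_left (Submodule.mem_sup_left ⟨hx, hxj⟩)
  refine ⟨K, sup_le ?_ ?_, hC.le fun j x hx hxj => ?_, hKD, hDK, le_antisymm ?_ ?_⟩
  · exact (le_inf le_sup_left inf_le_right).trans (inf_part_le K (i + 1))
  · exact (le_inf le_sup_right (inf_le_left.trans inf_le_right)).trans (inf_part_le K i)
  · obtain rfl | rfl := hi j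
    · exact Submodule.mem_sup_right ⟨⟨hCD hx, hxj⟩, hfC hx⟩
    · exact Submodule.mem_sup_left ⟨hCD hx, hxj⟩
  · exact Submodule.finrank_lt_finrank_of_lt (lt_of_le_of_ne hKD fun h => hzK (h ▸ hzD))
  · refine (Submodule.finrank_mono hDK).trans
      ((Submodule.finrank_add_le_finrank_add_finrank _ _).trans ?_)
    exact Nat.add_le_add_left (by simpa using finrank_span_le_card (R := F) {z}) _

end Graded

/-! ### Cocycles on a nilpotent Lie superalgebra -/

section Cocycle

variable {F : Type u} {L : Type v} [Field F] [AddCommGroup L] [Module F L] [LieSuperalgebra F L]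
  {W : Type*} [AddCommGroup W] [Module F W]

/-- Superskew bilinear maps satisfying the cocycle identity. -/
structure IsCocycle (g : L →ₗ[F] L →ₗ[F] W) : Prop where
  skew : ∀ i j : ZMod 2, ∀ x ∈ part (F := F) (L := L) i, ∀ y ∈ part (F := F) (L := L) j,
    g x y = -(koszulSign F i j • g y x)
  jacobi : ∀ i j k : ZMod 2, ∀ x ∈ part (F := F) (L := L) i, ∀ y ∈ part (F := F) (L := L) j,
    ∀ z ∈ part (F := F) (L := L) k,
    koszulSign F i k • g x (bracket (F := F) y z) + koszulSign F j i • g y (bracket (F := F) z x)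
      + koszulSign F k j • g z (bracket (F := F) x y) = 0

theorem isCocycle_bracket : IsCocycle (bracket (F := F) (L := L)) := ⟨skew, jacobi⟩

namespace IsCocycle

variable {g : L →ₗ[F] L →ₗ[F] W}

theorem map₂_comm_le (hg : IsCocycle g) {U V : Submodule F L} (hU : IsGraded U) (hV : IsGraded V) :
    Submodule.map₂ g U V ≤ Submodule.map₂ g V U :=
  map₂_le_of_isGraded hU hV fun i j x hx hxi y hy hyj => by
    rw [hg.skew i j x hxi y hyj]
    exact Submodule.neg_mem _ (Submodule.smul_mem _ _ (Submodule.apply_mem_map₂ _ hy hx))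

theorem swap_mem (hg : IsCocycle g) {i j : ZMod 2} {x y : L} (hx : x ∈ part (F := F) i)
    (hy : y ∈ part (F := F) j)
    {T : Submodule F W} (h : g y x ∈ T) : g x y ∈ T := by
  rw [hg.skew i j x hx y hy]
  exact Submodule.neg_mem _ (Submodule.smul_mem _ _ h)

/-- Koszul signs are nonzero scalars, so for membership in a subspace the cocycle identity can be
used without tracking them. -/
theorem jacobi_mem (hg : IsCocycle g) {i j k : ZMod 2} {x y z : L} (hx : x ∈ part (F := F) i)
    (hy : y ∈ part (F := F) j) (hz : z ∈ part (F := F) k) {T : Submodule F W}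
    (h1 : g y (bracket (F := F) z x) ∈ T) (h2 : g z (bracket (F := F) x y) ∈ T) :
    g x (bracket (F := F) y z) ∈ T := by
  have h := hg.jacobi i j k x hx y hy z hz
  rw [add_assoc, add_eq_zero_iff_eq_neg] at h
  rw [← Submodule.smul_mem_iff T (koszulSign_ne_zero (F := F) i k), h]
  exact Submodule.neg_mem _ (Submodule.add_mem _ (Submodule.smul_mem _ _ h1)
    (Submodule.smul_mem _ _ h2))

/-- If `L` is nilpotent and `L = S + L'`, then a graded ideal `K` satisfies `g(K, L) = g(K, S)`. -/
theorem map₂_top_le (hg : IsCocycle g) (hL : IsNilpotent F L)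
    {K S : Submodule F L} (hK : IsGraded K)
    (hKL : commutator F K ⊤ ≤ K) (hS : ⊤ ≤ S ⊔ derived F L) :
    Submodule.map₂ g K ⊤ ≤ Submodule.map₂ g K S := by
  obtain ⟨N, hN⟩ := hL
  -- Descending induction along the central series: at j = 0 the intersection with K is zero, at j =
  -- N it is K itself.
  have key : ∀ j, j ≤ N → Submodule.map₂ g (K ⊓ centralSeries F L (N - j)) ⊤
      ≤ Submodule.map₂ g K S := by
    intro j
    induction j with
    | zero => intro _; rw [Nat.sub_zero, hN, inf_bot_eq, Submodule.map₂_bot_left]; exact bot_le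
    | succ j ih =>
      intro hj
      have ih := ih (by omega)
      have hC : N - j = (N - (j + 1)) + 1 := by omega
      rw [hC] at ih
      have hKC := isGraded_inf hK (isGraded_centralSeries (N - (j + 1)))
      refine (Submodule.map₂_le_map₂_right hS).trans ?_
      rw [Submodule.map₂_sup_right, sup_le_iff]
      refine ⟨Submodule.map₂_le_map₂_left inf_le_left, ?_⟩
      refine map₂_le_of_isGraded hKC isGraded_derived fun i i' x hx hxi y hy _ => ?_
      -- For x in K ∩ Cⁱ, Jacobi rewrites g(x, [u, v]) through values of g on [x, u] and [x, v].
      -- Both brackets lie in K ∩ Cⁱ⁺¹, where the induction hypothesis applies.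
      have h1 : derived F L ≤ (Submodule.map₂ g K S).comap (g x) := by
        refine map₂_le_of_isGraded isGraded_top isGraded_top fun a b u _ hua v _ hvb => ?_
        have hb : ∀ c, ∀ t ∈ part (F := F) (L := L) c, ∀ c', ∀ t' ∈ part (F := F) (L := L) c',
            g t' (bracket (F := F) x t) ∈ Submodule.map₂ g K S := by
          intro c t ht c' t' ht'
          refine hg.swap_mem ht' (bracket_mem _ _ _ hxi _ ht) (ih ?_)
          exact Submodule.apply_mem_map₂ _ ⟨hKL (Submodule.apply_mem_map₂ _ hx.1 trivial),
            Submodule.apply_mem_map₂ _ hx.2 trivial⟩ trivial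
        refine hg.jacobi_mem hxi hua hvb ?_ (hb _ _ hua _ _ hvb)
        rw [LieSuperalgebra.skew _ _ _ hvb _ hxi, map_neg, map_smul]
        exact Submodule.neg_mem _ (Submodule.smul_mem _ _ (hb _ _ hvb _ _ hua))
      exact h1 hy
  have := key N le_rfl
  rwa [Nat.sub_self, show centralSeries F L 0 = ⊤ from rfl, inf_top_eq] at this

/-- If `y`, `w` are homogeneous and `L' = K + ⟨[y, w]⟩`, then `g(L', L)` is spanned by `g(K, L)`
together with two elements. -/
theorem map₂_derived_le (hg : IsCocycle g) {K : Submodule F L} (hK : IsGraded K)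
    {i j : ZMod 2} {y w : L}
    (hy : y ∈ part (F := F) i) (hw : w ∈ part (F := F) j)
    (hD : derived F L ≤ K ⊔ Submodule.span F {bracket (F := F) y w}) :
    Submodule.map₂ g (derived F L) ⊤ ≤ Submodule.map₂ g K ⊤ ⊔
      Submodule.span F {g y (bracket (F := F) y w), g w (bracket (F := F) y w)} := by
  set T := Submodule.map₂ g K ⊤ ⊔
      Submodule.span F {g y (bracket (F := F) y w), g w (bracket (F := F) y w)} with hT
  have hy1 : g y (bracket (F := F) y w) ∈ T :=
    Submodule.mem_sup_right (Submodule.subset_span (by simp))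
  have hw1 : g w (bracket (F := F) y w) ∈ T :=
    Submodule.mem_sup_right (Submodule.subset_span (by simp))
  have hKT : ∀ u, ∀ κ ∈ K, g u κ ∈ T := fun u κ hκ => Submodule.mem_sup_left
    (hg.map₂_comm_le isGraded_top hK (Submodule.apply_mem_map₂ _ trivial hκ))
  have hDT : ∀ u, g u (bracket (F := F) y w) ∈ T → ∀ d ∈ derived F L, g u d ∈ T := by
    intro u hu d hd
    have : K ⊔ Submodule.span F {bracket (F := F) y w} ≤ T.comap (g u) := by
      rw [sup_le_iff, Submodule.span_singleton_le_iff_mem]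
      exact ⟨fun κ hκ => hKT u κ hκ, hu⟩
    exact this (hD hd)
  refine (hg.map₂_comm_le isGraded_derived isGraded_top).trans ?_
  have hder : ∀ a b : L, bracket (F := F) a b ∈ derived F L := fun a b =>
    Submodule.apply_mem_map₂ _ trivial trivial
  refine map₂_le_of_isGraded isGraded_top isGraded_derived fun a _ x _ hxa d hd _ => ?_
  -- Jacobi turns g(x, [y, w]) into g(y, [w, x]) and g(w, [x, y]). Their second arguments lie in L'
  -- = K + ⟨[y, w]⟩, so only the two listed generators arise besides g(K, L).
  exact hDT x (hg.jacobi_mem hxa hy hw (hDT y hy1 _ (hder _ _)) (hDT w hw1 _ (hder _ _))) d hd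

/-- A superskew form on the span of `p` even and `q` odd elements. -/
theorem finrank_map₂_span_le (hg : IsCocycle g) (h2 : (2 : F) ≠ 0) {p q : ℕ} {e : Fin p → L}
    {o : Fin q → L}
    (he : ∀ a, e a ∈ part (F := F) (L := L) 0) (ho : ∀ a, o a ∈ part (F := F) (L := L) 1) :
    Module.finrank F (Submodule.map₂ g (Submodule.span F (Set.range e ∪ Set.range o))
      (Submodule.span F (Set.range e ∪ Set.range o))) ≤ (p + q) * (p + q - 1) / 2 + q := by
  let σ : Fin p ⊕ Fin q ≃ Fin (p + q) := finSumFinEquiv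
  let x : Fin (p + q) → L := fun a => Sum.elim e o (σ.symm a)
  have hx : ∀ a, ∃ i, x a ∈ part (F := F) (L := L) i := by
    intro a
    change ∃ i, Sum.elim e o (σ.symm a) ∈ _
    rcases σ.symm a with b | b
    · exact ⟨0, he b⟩
    · exact ⟨1, ho b⟩
  have hxr : Set.range e ∪ Set.range o = Set.range x := by
    rw [← Set.Sum.elim_range]
    exact (σ.symm.surjective.range_comp _).symm
  -- By skew-symmetry it suffices to take the pairs a < b and the diagonal values at odd generators.
  -- The even diagonal values vanish because 2 is invertible.
  let f : (Σ j : Fin (p + q), Fin j) ⊕ Fin q → W :=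
    Sum.elim (fun c => g (x (c.2.castLE c.1.2.le)) (x c.1)) (fun c => g (o c) (o c))
  have hle : Submodule.map₂ g (Submodule.span F (Set.range e ∪ Set.range o))
      (Submodule.span F (Set.range e ∪ Set.range o)) ≤ Submodule.span F (Set.range f) := by
    have hlt : ∀ a b, a < b → g (x a) (x b) ∈ Submodule.span F (Set.range f) := fun a b hab =>
      Submodule.subset_span ⟨Sum.inl ⟨b, ⟨a, hab⟩⟩, rfl⟩
    rw [hxr, Submodule.map₂_span_span, Submodule.span_le]
    rintro _ ⟨_, ⟨a, rfl⟩, _, ⟨b, rfl⟩, rfl⟩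
    rcases lt_trichotomy a b with hab | rfl | hab
    · exact hlt a b hab
    · change g (Sum.elim e o (σ.symm a)) (Sum.elim e o (σ.symm a)) ∈ _
      rcases σ.symm a with c | c
      · have h := hg.skew 0 0 _ (he c) _ (he c)
        rw [koszulSign_zero_left, one_smul, eq_neg_iff_add_eq_zero, ← two_smul F] at h
        change g (e c) (e c) ∈ _
        rw [(smul_eq_zero.1 h).resolve_left h2]
        exact Submodule.zero_mem _
      · exact Submodule.subset_span ⟨Sum.inr c, rfl⟩
    · obtain ⟨i, hi⟩ := hx a
      obtain ⟨j, hj⟩ := hx b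
      exact hg.swap_mem hi hj (hlt b a hab)
  have : FiniteDimensional F (Submodule.span F (Set.range f)) :=
    FiniteDimensional.span_of_finite F (Set.finite_range f)
  refine (Submodule.finrank_mono hle).trans ((finrank_range_le_card f).trans ?_)
  rw [Fintype.card_sum, Fintype.card_sigma, Fintype.card_fin]
  simp only [Fintype.card_fin]
  rw [Fin.sum_univ_eq_sum_range (fun i => i), Finset.sum_range_id]

end IsCocycle

end Cocycle

/-! ### The upper bound -/

section UpperBound

variable {F : Type u} {L : Type v} [Field F] [AddCommGroup L] [Module F L] [LieSuperalgebra F L]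
  {W : Type*} [AddCommGroup W] [Module F W]

theorem bracket_mem_derived (x y : L) : bracket (F := F) x y ∈ derived F L :=
  Submodule.apply_mem_map₂ _ trivial trivial

/-- Otherwise L' would lie in every term of the central series. The consequence used later is a
homogeneous bracket [y, w] outside [L', L]. -/
theorem not_derived_le (hL : IsNilpotent F L) (hD : derived F L ≠ ⊥) :
    ¬ derived F L ≤ commutator F (derived F L) ⊤ := by
  intro h
  have key : ∀ j, derived F L ≤ centralSeries F L j := by
    intro j
    induction j with
    | zero => exact le_top
    | succ j ih => exact h.trans (Submodule.map₂_le_map₂_left ih)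
  obtain ⟨N, hN⟩ := hL
  exact hD (le_bot_iff.1 (hN ▸ key N))

theorem finrank_eq_add_of_superdim [FiniteDimensional F L] {U : Submodule F L} (hU : IsGraded U)
    {a b : ℕ} (h : superdim F U = (a, b)) : Module.finrank F U = a + b := by
  obtain ⟨ha, hb⟩ := Prod.mk.inj h
  have hd : (U ⊓ part (F := F) (L := L) 0) ⊓ (U ⊓ part 1) = ⊥ := by
    rw [eq_bot_iff]
    exact fun x hx => eq_zero_of_mem_parts hx.1.2 hx.2.2
  have hs : U = (U ⊓ part 0) ⊔ (U ⊓ part 1) := le_antisymm hU (sup_le inf_le_left inf_le_left)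
  have := Submodule.finrank_sup_add_finrank_inf_eq (U ⊓ part (F := F) (L := L) 0) (U ⊓ part 1)
  rw [hd, finrank_bot, add_zero, ← hs, ha, hb] at this
  exact this

theorem exists_span_sup_eq {F L : Type*} [Field F] [AddCommGroup L] [Module F L]
    [FiniteDimensional F L] {U V : Submodule F L} (hUV : U ≤ V) {p : ℕ}
    (h : p + Module.finrank F U = Module.finrank F V) :
    ∃ e : Fin p → L, (∀ a, e a ∈ V) ∧ LinearIndependent F e ∧
      Disjoint U (Submodule.span F (Set.range e)) ∧ U ⊔ Submodule.span F (Set.range e) = V := by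
  obtain ⟨C, hC, rfl⟩ := IsModularLattice.exists_disjoint_and_sup_eq hUV
  have hf : Module.finrank F C = p := by
    have := Submodule.finrank_sup_add_finrank_inf_eq U C
    rw [disjoint_iff.1 hC, finrank_bot] at this
    omega
  let b := Module.finBasisOfFinrankEq F C hf
  have hs : Submodule.span F (Set.range fun a => (b a : L)) = C := by
    have := congrArg (Submodule.map C.subtype) b.span_eq
    rwa [Submodule.map_span, ← Set.range_comp, Submodule.map_top, Submodule.range_subtype] at this
  exact ⟨fun a => b a, fun a => Submodule.mem_sup_right (b a).2,
    b.linearIndependent.map' C.subtype C.ker_subtype, by rwa [hs], by rw [hs]⟩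

/-- Complements of L' are chosen in each degree separately, which keeps count of the even and the
odd generators. -/
theorem exists_homogeneous_generators [FiniteDimensional F L] {p q r s : ℕ}
    (hmn : superdim F (⊤ : Submodule F L) = (p + r, q + s))
    (hrs : superdim F (derived F L) = (r, s)) :
    ∃ (e : Fin p → L) (o : Fin q → L), (∀ a, e a ∈ part (F := F) (L := L) 0) ∧
      (∀ a, o a ∈ part (F := F) (L := L) 1) ∧
      ⊤ ≤ Submodule.span F (Set.range e ∪ Set.range o) ⊔ derived F L := by
  obtain ⟨hm, hn⟩ := Prod.mk.inj hmn
  obtain ⟨hr, hs⟩ := Prod.mk.inj hrs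
  rw [top_inf_eq] at hm hn
  obtain ⟨e, he, -, -, he'⟩ := exists_span_sup_eq (p := p)
    (inf_le_right : derived F L ⊓ part (F := F) 0 ≤ part 0) (by rw [hr, hm])
  obtain ⟨o, ho, -, -, ho'⟩ := exists_span_sup_eq (p := q)
    (inf_le_right : derived F L ⊓ part (F := F) 1 ≤ part 1) (by rw [hs, hn])
  refine ⟨e, o, he, ho, ?_⟩
  rw [← isCompl.sup_eq_top, ← he', ← ho', Submodule.span_union]
  refine sup_le (sup_le ?_ ?_) (sup_le ?_ ?_)
  · exact inf_le_left.trans le_sup_right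
  · exact le_sup_left.trans le_sup_left
  · exact inf_le_left.trans le_sup_right
  · exact le_sup_right.trans le_sup_left

namespace IsCocycle

variable {g : L →ₗ[F] L →ₗ[F] W} [FiniteDimensional F L] {p q r s : ℕ}

/-- Both arguments are expanded along L = S + L'; every mixed term is absorbed into g(L', L). -/
theorem finrank_map₂_top_le (hg : IsCocycle g) (h2 : (2 : F) ≠ 0)
    (hmn : superdim F (⊤ : Submodule F L) = (p + r, q + s))
    (hrs : superdim F (derived F L) = (r, s)) :
    Module.finrank F (Submodule.map₂ g ⊤ ⊤) ≤ (p + q) * (p + q - 1) / 2 + q +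
      Module.finrank F (Submodule.map₂ g (derived F L) ⊤) := by
  obtain ⟨e, o, he, ho, hS⟩ := exists_homogeneous_generators hmn hrs
  have h1 := hg.finrank_map₂_span_le h2 he ho
  set S := Submodule.span F (Set.range e ∪ Set.range o)
  have hfin : ∀ U V : Submodule F L, FiniteDimensional F (Submodule.map₂ g U V) := fun U V =>
    Module.Finite.iff_fg.2 (Submodule.FG.map₂ g (Submodule.FG.of_finite) (Submodule.FG.of_finite))
  have := hfin S S
  have := hfin (derived F L) ⊤
  have hle : Submodule.map₂ g ⊤ ⊤ ≤ Submodule.map₂ g S S ⊔ Submodule.map₂ g (derived F L) ⊤ := by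
    refine (Submodule.map₂_le_map₂_left hS).trans ?_
    rw [Submodule.map₂_sup_left]
    refine sup_le ?_ le_sup_right
    refine (Submodule.map₂_le_map₂_right hS).trans ?_
    rw [Submodule.map₂_sup_right]
    exact sup_le_sup le_rfl ((Submodule.map₂_le_map₂_left le_top).trans
      (hg.map₂_comm_le isGraded_top isGraded_derived))
  exact (Submodule.finrank_mono hle).trans
    ((Submodule.finrank_add_le_finrank_add_finrank _ _).trans (Nat.add_le_add_right h1 _))

theorem finrank_map₂_derived_le (hg : IsCocycle g) (hL : IsNilpotent F L)
    (hmn : superdim F (⊤ : Submodule F L) = (p + r, q + s))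
    (hrs : superdim F (derived F L) = (r, s)) (h1 : 1 ≤ r + s) :
    Module.finrank F (Submodule.map₂ g (derived F L) ⊤) ≤ (r + s - 1) * (p + q) + 2 := by
  have hk := finrank_eq_add_of_superdim isGraded_derived hrs
  have hD : derived F L ≠ ⊥ := by
    intro h
    rw [h, finrank_bot] at hk
    omega
  obtain ⟨i, j, y, hy, w, hw, hz⟩ : ∃ i j, ∃ y ∈ part (F := F) (L := L) i,
      ∃ w ∈ part (F := F) (L := L) j, bracket (F := F) y w ∉ commutator F (derived F L) ⊤ := by
    by_contra! hcon
    exact not_derived_le hL hD (map₂_le_of_isGraded isGraded_top isGraded_top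
      fun i j x _ hx y _ hy => hcon i j x hx y hy)
  have hCD : commutator F (derived F L) ⊤ ≤ derived F L := Submodule.map₂_le_map₂_left le_top
  obtain ⟨K, hK, hCK, hKD, hDK, hfK⟩ := exists_isGraded_hyperplane
    (isGraded_commutator isGraded_derived isGraded_top) isGraded_derived hCD
    (bracket_mem _ _ _ hy _ hw) (bracket_mem_derived y w) hz
  obtain ⟨e, o, -, -, hS⟩ := exists_homogeneous_generators hmn hrs
  -- K is an ideal, since [K, L] ≤ [L', L] ≤ K; hence g(K, L) may be replaced by g(K, S).
  have hle := (hg.map₂_derived_le hK hy hw hDK).trans (sup_le_sup (hg.map₂_top_le hL hK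
    ((Submodule.map₂_le_map₂_left hKD).trans hCK) hS) le_rfl)
  have hSf : Module.finrank F (Submodule.span F (Set.range e ∪ Set.range o)) ≤ p + q := by
    rw [← Set.Sum.elim_range]
    exact (finrank_range_le_card _).trans (by simp)
  set S := Submodule.span F (Set.range e ∪ Set.range o)
  have : FiniteDimensional F (Submodule.map₂ g K S) :=
    Module.Finite.iff_fg.2 (Submodule.FG.map₂ g (Submodule.FG.of_finite) (Submodule.FG.of_finite))
  have hpair : ∀ a b : W, FiniteDimensional F (Submodule.span F {a, b}) ∧
      Module.finrank F (Submodule.span F {a, b}) ≤ 2 := fun a b => by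
    classical
    refine ⟨FiniteDimensional.span_of_finite F (Set.toFinite _), ?_⟩
    have := finrank_span_finset_le_card (R := F) ({a, b} : Finset W)
    rw [Finset.coe_pair] at this
    exact this.trans Finset.card_le_two
  obtain ⟨_, hp⟩ := hpair (g y (bracket (F := F) y w)) (g w (bracket (F := F) y w))
  refine (Submodule.finrank_mono hle).trans
    ((Submodule.finrank_add_le_finrank_add_finrank _ _).trans (Nat.add_le_add ?_ hp))
  -- K has dimension r + s - 1, being a hyperplane in L'.
  exact (finrank_map₂_le g K S).trans (Nat.mul_le_mul (by omega) hSf)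

end IsCocycle

end UpperBound

/-! ### The cover 𝓕 / [𝓕, R] and the dimension of the multiplier -/

section Cover

variable {F : Type u} {L : Type v} [Field F] [AddCommGroup L] [Module F L] [LieSuperalgebra F L]

/-- In any preimage, the component of the wrong degree maps to an element of both parts, that is, to
zero, and can be dropped. -/
theorem exists_homogeneous_lift {E : Type*} [AddCommGroup E] [Module F E] [LieSuperalgebra F E]
    (ψ : Hom F E L) (hψ : Function.Surjective ψ.toLinearMap) {i : ZMod 2} {x : L}
    (hx : x ∈ part (F := F) i) : ∃ y ∈ part (F := F) (L := E) i, ψ.toLinearMap y = x := by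
  obtain ⟨y, rfl⟩ := hψ x
  obtain ⟨a, ha, b, hb, rfl⟩ := exists_add_of_part (F := F) y
  have ha' := ψ.map_part 0 a ha
  have hb' := ψ.map_part 1 b hb
  rw [map_add] at hx ⊢
  obtain rfl | rfl := ZMod.eq_zero_or_one_of_two i
  · refine ⟨a, ha, ?_⟩
    rw [eq_zero_of_mem_parts (by simpa using Submodule.sub_mem _ hx ha') hb', add_zero]
  · refine ⟨b, hb, ?_⟩
    rw [eq_zero_of_mem_parts ha' (by simpa using Submodule.sub_mem _ hx hb'), zero_add]

/-- The bracket of an extension `E → L` with kernel `R`, taken modulo `[E, R]`, descends to a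
cocycle on `L`. -/
theorem exists_isCocycle_of_surjective {E : Type*} [AddCommGroup E] [Module F E]
    [LieSuperalgebra F E] (ψ : Hom F E L) (hψ : Function.Surjective ψ.toLinearMap) :
    ∃ g : L →ₗ[F] L →ₗ[F] E ⧸ commutator F ⊤ (LinearMap.ker ψ.toLinearMap), IsCocycle g ∧
      ∀ x y, g (ψ.toLinearMap x) (ψ.toLinearMap y) =
        (commutator F ⊤ (LinearMap.ker ψ.toLinearMap)).mkQ (bracket (F := F) x y) := by
  set N := commutator F ⊤ (LinearMap.ker ψ.toLinearMap) with hN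
  obtain ⟨σ, hσ⟩ := ψ.toLinearMap.exists_rightInverse_of_surjective
    (LinearMap.range_eq_top.2 hψ)
  have hσ' : ∀ x, ψ.toLinearMap (σ x) = x := fun x => LinearMap.congr_fun hσ x
  -- The linear section σ need not respect the grading or the bracket. Two lifts differ by elements
  -- of the kernel, whose brackets vanish modulo N, so g does not depend on σ.
  let g : L →ₗ[F] L →ₗ[F] E ⧸ N := ((bracket (F := F) (L := E)).compl₁₂ σ σ).compr₂ N.mkQ
  have hg : ∀ x y, g (ψ.toLinearMap x) (ψ.toLinearMap y) = N.mkQ (bracket (F := F) x y) := by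
    intro x y
    change N.mkQ (bracket (F := F) (σ (ψ.toLinearMap x)) (σ (ψ.toLinearMap y))) = _
    rw [← sub_eq_zero, ← map_sub, Submodule.mkQ_apply, Submodule.Quotient.mk_eq_zero]
    have hker : ∀ x, σ (ψ.toLinearMap x) - x ∈ LinearMap.ker ψ.toLinearMap := fun x => by
      rw [LinearMap.mem_ker, map_sub, hσ', sub_self]
    have h : bracket (F := F) (σ (ψ.toLinearMap x)) (σ (ψ.toLinearMap y)) - bracket (F := F) x y
        = bracket (F := F) (σ (ψ.toLinearMap x)) (σ (ψ.toLinearMap y) - y)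
          + bracket (F := F) (σ (ψ.toLinearMap x) - x) y := by
      simp only [map_sub, LinearMap.sub_apply]; abel
    rw [h]
    exact Submodule.add_mem _ (Submodule.apply_mem_map₂ _ trivial (hker y))
      (isCocycle_bracket.map₂_comm_le (isGraded_ker ψ) isGraded_top
        (Submodule.apply_mem_map₂ _ (hker x) trivial))
  refine ⟨g, ⟨?_, ?_⟩, hg⟩
  · intro i j x hx y hy
    obtain ⟨x, hx', rfl⟩ := exists_homogeneous_lift ψ hψ hx
    obtain ⟨y, hy', rfl⟩ := exists_homogeneous_lift ψ hψ hy
    rw [hg, hg, skew i j x hx' y hy', map_neg, map_smul]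
  · intro i j k x hx y hy z hz
    obtain ⟨x, hx', rfl⟩ := exists_homogeneous_lift ψ hψ hx
    obtain ⟨y, hy', rfl⟩ := exists_homogeneous_lift ψ hψ hy
    obtain ⟨z, hz', rfl⟩ := exists_homogeneous_lift ψ hψ hz
    rw [← ψ.map_bracket, ← ψ.map_bracket, ← ψ.map_bracket, hg, hg, hg]
    have h := congrArg N.mkQ (jacobi i j k x hx' y hy' z hz')
    simpa only [map_add, LinearMap.map_smul N.mkQ, map_zero] using h

theorem map_derived {E : Type*} [AddCommGroup E] [Module F E] [LieSuperalgebra F E]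
    (ψ : Hom F E L) (hψ : Function.Surjective ψ.toLinearMap) :
    (derived F E).map ψ.toLinearMap = derived F L := by
  refine le_antisymm (Submodule.map_le_iff_le_comap.2 (Submodule.map₂_le.2 ?_))
    (Submodule.map₂_le.2 ?_)
  · intro x _ y _
    rw [Submodule.mem_comap, ψ.map_bracket]
    exact bracket_mem_derived _ _
  · intro x _ y _
    obtain ⟨x, rfl⟩ := hψ x
    obtain ⟨y, rfl⟩ := hψ y
    exact ⟨_, bracket_mem_derived x y, ψ.map_bracket x y⟩

/-- Rank-nullity for h restricted to f(D). It is meant for f the quotient by [𝓕, R], h the induced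
map to L and D = [𝓕, 𝓕]. -/
theorem finrank_map_add_finrank_map_inf_ker {F V W U : Type*} [Field F] [AddCommGroup V]
    [Module F V] [AddCommGroup W] [Module F W] [AddCommGroup U] [Module F U]
    (f : V →ₗ[F] W) (h : W →ₗ[F] U) (D : Submodule F V) [FiniteDimensional F (D.map f)] :
    Module.finrank F (D.map (h ∘ₗ f)) + Module.finrank F ((D ⊓ LinearMap.ker (h ∘ₗ f)).map f)
      = Module.finrank F (D.map f) := by
  have key := LinearMap.finrank_range_add_finrank_ker (h.domRestrict (D.map f))
  rw [LinearMap.range_domRestrict, ← Submodule.map_comp] at key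
  rw [← key]
  congr 1
  have : (D ⊓ LinearMap.ker (h ∘ₗ f)).map f =
      (LinearMap.ker (h.domRestrict (D.map f))).map (D.map f).subtype := by
    ext x
    constructor
    · rintro ⟨y, ⟨hy, hy'⟩, rfl⟩
      exact ⟨⟨f y, Submodule.mem_map_of_mem hy⟩, hy', rfl⟩
    · rintro ⟨⟨_, y, hy, rfl⟩, hy', rfl⟩
      exact ⟨y, ⟨hy, hy'⟩, rfl⟩
  rw [this]
  exact (Submodule.equivSubtypeMap _ _).finrank_eq.symm

variable [FiniteDimensional F L] {X : Type w} {deg : X → ZMod 2}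

/-- The multiplier is finite-dimensional, and its dimension is determined by the dimension of
the derived subalgebra `[𝓕, 𝓕] / [𝓕, R]` of the cover `𝓕 / [𝓕, R]`. -/
theorem finrank_multiplier_add (ψ : Hom F (Free F deg) L)
    (hψ : Function.Surjective ψ.toLinearMap) :
    ∃ g : L →ₗ[F] L →ₗ[F] Free F deg ⧸ commutator F ⊤ (LinearMap.ker ψ.toLinearMap),
      IsCocycle g ∧
      (∀ x y, g (ψ.toLinearMap x) (ψ.toLinearMap y) =
        (commutator F ⊤ (LinearMap.ker ψ.toLinearMap)).mkQ (bracket (F := F) x y)) ∧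
      FiniteDimensional F (Multiplier ψ) ∧
      Module.finrank F (Multiplier ψ) + Module.finrank F (derived F L) =
        Module.finrank F (Submodule.map₂ g ⊤ ⊤) := by
  set N := commutator F ⊤ (LinearMap.ker ψ.toLinearMap) with hN
  obtain ⟨g, hg, hgψ⟩ : ∃ g : L →ₗ[F] L →ₗ[F] Free F deg ⧸ N, IsCocycle g ∧
      ∀ x y, g (ψ.toLinearMap x) (ψ.toLinearMap y) = N.mkQ (bracket (F := F) x y) :=
    exists_isCocycle_of_surjective ψ hψ
  refine ⟨g, hg, hgψ, ?_⟩
  have hNker : N ≤ LinearMap.ker ψ.toLinearMap := Submodule.map₂_le.2 fun x _ y hy => by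
    rw [LinearMap.mem_ker] at hy ⊢
    rw [ψ.map_bracket, hy, map_zero]
  have hmap : Submodule.map₂ g ⊤ ⊤ = (derived F (Free F deg)).map N.mkQ := by
    refine le_antisymm (Submodule.map₂_le.2 ?_)
      (Submodule.map_le_iff_le_comap.2 (Submodule.map₂_le.2 ?_))
    · intro x _ y _
      obtain ⟨x, rfl⟩ := hψ x
      obtain ⟨y, rfl⟩ := hψ y
      rw [hgψ]
      exact Submodule.mem_map_of_mem (bracket_mem_derived x y)
    · intro x _ y _
      rw [Submodule.mem_comap, ← hgψ]
      exact Submodule.apply_mem_map₂ _ trivial trivial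
  -- Although 𝓕 may be infinite-dimensional, [𝓕, 𝓕]/[𝓕, R] is spanned by the values of a bilinear
  -- map on the finite-dimensional L. This is the source of the finiteness of the multiplier.
  have hfin : FiniteDimensional F ((derived F (Free F deg)).map N.mkQ) := hmap ▸
    Module.Finite.iff_fg.2 (Submodule.FG.map₂ g (Submodule.FG.of_finite) (Submodule.FG.of_finite))
  have hcomp : (N.liftQ ψ.toLinearMap hNker) ∘ₗ N.mkQ = ψ.toLinearMap := N.liftQ_mkQ _ _
  have hdim := finrank_map_add_finrank_map_inf_ker N.mkQ (N.liftQ ψ.toLinearMap hNker)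
    (derived F (Free F deg))
  rw [hcomp, map_derived ψ hψ, ← hmap] at hdim
  set D := derived F (Free F deg) ⊓ LinearMap.ker ψ.toLinearMap
  have e : Multiplier ψ ≃ₗ[F] D.map N.mkQ := by
    refine (Submodule.quotEquivOfEq _ _ ?_).trans
      ((LinearMap.quotKerEquivRange (N.mkQ.domRestrict D)).trans
        (LinearEquiv.ofEq _ _ (LinearMap.range_domRestrict _ _)))
    rw [LinearMap.ker_domRestrict, Submodule.ker_mkQ]
    rfl
  have hfin' : FiniteDimensional F (D.map N.mkQ) :=
    Submodule.finiteDimensional_of_le (Submodule.map_mono inf_le_left)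
  exact ⟨e.symm.finiteDimensional, by rw [e.finrank_eq, add_comm]; exact hdim⟩

end Cover

/-! ### Cocycles bound the cover from below -/

section LowerBound

variable {F : Type u} {L : Type v} [Field F] [AddCommGroup L] [Module F L] [LieSuperalgebra F L]
  {W : Type*} [AddCommGroup W] [Module F W]

/-- The central extension of `L` by the superspace `W = P 0 ⊕ P 1` defined by an even cocycle. -/
@[reducible]
def centralExtension (P : ZMod 2 → Submodule F W) (hP : IsCompl (P 0) (P 1))
    (h : L →ₗ[F] L →ₗ[F] W) (hh : IsCocycle h)
    (hdeg : ∀ i j, ∀ x ∈ part (F := F) (L := L) i, ∀ y ∈ part (F := F) (L := L) j,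
      h x y ∈ P (i + j)) : LieSuperalgebra F (L × W) where
  part i := (part i).prod (P i)
  isCompl := by
    have hL := LieSuperalgebra.isCompl (F := F) (L := L)
    constructor
    · rw [disjoint_iff, Submodule.prod_inf_prod, hL.inf_eq_bot, hP.inf_eq_bot, Submodule.prod_bot]
    · rw [codisjoint_iff, Submodule.prod_sup_prod, hL.sup_eq_top, hP.sup_eq_top,
        Submodule.prod_top]
  bracket := LinearMap.mk₂ F (fun x y => (bracket (F := F) x.1 y.1, h x.1 y.1))
    (by intros; simp) (by intros; simp) (by intros; simp) (by intros; simp)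
  bracket_mem i j x hx y hy := ⟨bracket_mem i j _ hx.1 _ hy.1, hdeg i j _ hx.1 _ hy.1⟩
  skew i j x hx y hy := Prod.ext (skew i j _ hx.1 _ hy.1) (hh.skew i j _ hx.1 _ hy.1)
  jacobi i j k x hx y hy z hz :=
    Prod.ext (jacobi i j k _ hx.1 _ hy.1 _ hz.1) (hh.jacobi i j k _ hx.1 _ hy.1 _ hz.1)

theorem Free.of_mem_part {X : Type w} (deg : X → ZMod 2) (x : X) :
    Free.of F deg x ∈ part (F := F) (L := Free F deg) (deg x) :=
  ⟨_, word_mem_wordPart F deg (FreeMagma.of x), rfl⟩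

theorem Free.hom_ext {X : Type w} {deg : X → ZMod 2} {f g : Hom F (Free F deg) L}
    (h : ∀ x, f.toLinearMap (Free.of F deg x) = g.toLinearMap (Free.of F deg x)) : f = g :=
  (Free.existsUnique_hom F deg (φ := fun x => g.toLinearMap (Free.of F deg x))
    fun x => g.map_part _ _ (Free.of_mem_part deg x)).unique h fun _ => rfl

/-- Every even cocycle on `L` factors through the cover `𝓕 / [𝓕, R]`. -/
theorem finrank_map₂_le_of_free [FiniteDimensional F L] {X : Type w} {deg : X → ZMod 2}
    (ψ : Hom F (Free F deg) L) (hψ : Function.Surjective ψ.toLinearMap)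
    {g : L →ₗ[F] L →ₗ[F] Free F deg ⧸ commutator F ⊤ (LinearMap.ker ψ.toLinearMap)}
    (hg : ∀ x y, g (ψ.toLinearMap x) (ψ.toLinearMap y) =
        (commutator F ⊤ (LinearMap.ker ψ.toLinearMap)).mkQ (bracket (F := F) x y))
    (P : ZMod 2 → Submodule F W) (hP : IsCompl (P 0) (P 1))
    (h : L →ₗ[F] L →ₗ[F] W) (hh : IsCocycle h)
    (hdeg : ∀ i j, ∀ x ∈ part (F := F) (L := L) i, ∀ y ∈ part (F := F) (L := L) j,
      h x y ∈ P (i + j)) :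
    Module.finrank F (Submodule.map₂ h ⊤ ⊤) ≤ Module.finrank F (Submodule.map₂ g ⊤ ⊤) := by
  let := centralExtension P hP h hh hdeg
  -- Freeness lifts ψ to the central extension; the W-components of the generators are arbitrary and
  -- set to zero.
  obtain ⟨Φ, hΦ, -⟩ := Free.existsUnique_hom F (M := L × W) deg
    (φ := fun x => (ψ.toLinearMap (Free.of F deg x), 0))
    fun x => Submodule.mem_prod.2 ⟨ψ.map_part _ _ (Free.of_mem_part deg x), Submodule.zero_mem _⟩
  let Ψ : Hom F (Free F deg) L :=
    { toLinearMap := LinearMap.fst F L W ∘ₗ Φ.toLinearMap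
      map_part := fun i x hx => (Φ.map_part i x hx).1
      map_bracket := fun x y => congrArg Prod.fst (Φ.map_bracket x y) }
  have hΨ : Ψ = ψ := Free.hom_ext fun x => congrArg Prod.fst (hΦ x)
  have hfst : ∀ x, (Φ.toLinearMap x).1 = ψ.toLinearMap x := fun x => by rw [← hΨ]; rfl
  -- On brackets θ equals h evaluated on images in L, so θ kills [𝓕, R] and induces a map T on the
  -- cover with h = T ∘ g.
  let θ : Free F deg →ₗ[F] W := LinearMap.snd F L W ∘ₗ Φ.toLinearMap
  have hθ : ∀ x y, θ (bracket (F := F) x y) = h (ψ.toLinearMap x) (ψ.toLinearMap y) := by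
    intro x y
    rw [← hfst, ← hfst]
    exact congrArg Prod.snd (Φ.map_bracket x y)
  let T := (commutator F ⊤ (LinearMap.ker ψ.toLinearMap)).liftQ θ (Submodule.map₂_le.2 (by
    intro x _ y hy
    rw [LinearMap.mem_ker] at hy ⊢
    rw [hθ, hy, map_zero]))
  have : FiniteDimensional F (Submodule.map₂ g ⊤ ⊤) :=
    Module.Finite.iff_fg.2 (Submodule.FG.map₂ g (Submodule.FG.of_finite) (Submodule.FG.of_finite))
  have hle : Submodule.map₂ h ⊤ ⊤ ≤ (Submodule.map₂ g ⊤ ⊤).map T := by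
    rw [Submodule.map₂_le]
    intro x _ y _
    obtain ⟨x, rfl⟩ := hψ x
    obtain ⟨y, rfl⟩ := hψ y
    refine ⟨g (ψ.toLinearMap x) (ψ.toLinearMap y), Submodule.apply_mem_map₂ g trivial trivial, ?_⟩
    rw [hg, ← hθ]
    rfl
  exact (Submodule.finrank_mono hle).trans (Submodule.finrank_map_le _ _)

/-- The wedge product of two linear forms, with sign `ε`. -/
def wedge {L : Type*} [AddCommGroup L] [Module F L] (ε : F) (α β : L →ₗ[F] F) : L →ₗ[F] L →ₗ[F] F :=
  (LinearMap.mul F F).compl₁₂ α β - ε • (LinearMap.mul F F).compl₁₂ β α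

theorem wedge_apply {L : Type*} [AddCommGroup L] [Module F L] (ε : F) (α β : L →ₗ[F] F) (x y : L) :
    wedge ε α β x y = α x * β y - ε * (β x * α y) := rfl

/-- A linear form is homogeneous of degree `i` if it vanishes on the other part. -/
def IsHomogeneousForm (i : ZMod 2) (α : L →ₗ[F] F) : Prop :=
  ∀ j, j ≠ i → ∀ x ∈ part (F := F) (L := L) j, α x = 0

theorem koszulSign_mul_self (i j : ZMod 2) : koszulSign F i j * koszulSign F i j = 1 := by
  rw [koszulSign, ← mul_pow]; simp

theorem koszulSign_comm (i j : ZMod 2) : koszulSign F i j = koszulSign F j i := by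
  rw [koszulSign, koszulSign, mul_comm]

/-- The product vanishes unless x and y have degrees i and j, and then the two signs are equal. -/
theorem IsHomogeneousForm.koszulSign_mul {i j k l : ZMod 2} {α β : L →ₗ[F] F}
    (hα : IsHomogeneousForm i α) (hβ : IsHomogeneousForm j β) {x y : L}
    (hx : x ∈ part (F := F) k) (hy : y ∈ part (F := F) l) :
    koszulSign F k l * (α x * β y) = koszulSign F i j * (α x * β y) := by
  by_cases hk : k = i
  · by_cases hl : l = j
    · rw [hk, hl]
    · simp [hβ l hl y hy]
  · simp [hα k hk x hx]

theorem wedge_skew {i j : ZMod 2} {α β : L →ₗ[F] F} (hα : IsHomogeneousForm i α)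
    (hβ : IsHomogeneousForm j β) (k l : ZMod 2) (x : L) (hx : x ∈ part (F := F) k) (y : L)
    (hy : y ∈ part (F := F) l) : wedge (koszulSign F i j) α β x y
      = -(koszulSign F k l • wedge (koszulSign F i j) α β y x) := by
  have h1 := hα.koszulSign_mul hβ hx hy
  have h2 := hβ.koszulSign_mul hα hx hy
  rw [koszulSign_comm j i] at h2
  rw [wedge_apply, wedge_apply, smul_eq_mul]
  linear_combination (-koszulSign F i j) * h1 + h2 - (α x * β y) * koszulSign_mul_self (F := F) i j

theorem isCocycle_wedge {i j : ZMod 2} {α β : L →ₗ[F] F} (hα : IsHomogeneousForm i α)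
    (hβ : IsHomogeneousForm j β) (hα' : ∀ x y, α (bracket (F := F) x y) = 0)
    (hβ' : ∀ x y, β (bracket (F := F) x y) = 0) :
    IsCocycle (wedge (koszulSign F i j) α β) :=
  ⟨wedge_skew hα hβ, by intros; simp [wedge_apply, hα', hβ']⟩

/-- On even arguments the Jacobi sum is the triple product γ ∧ α ∧ β, which vanishes because γ
repeats a factor. With an odd argument every term contains a form evaluated at it, hence is zero. -/
theorem isCocycle_wedge_of_bracket {α β γ ζ : L →ₗ[F] F} (hα : IsHomogeneousForm 0 α)
    (hβ : IsHomogeneousForm 0 β) (hζ : IsHomogeneousForm 0 ζ)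
    (hα' : ∀ x y, α (bracket (F := F) x y) = 0) (hβ' : ∀ x y, β (bracket (F := F) x y) = 0)
    (hζ' : ∀ x y, ζ (bracket (F := F) x y) = α x * β y - β x * α y) (hγ : γ = α ∨ γ = β) :
    IsCocycle (wedge (koszulSign F 0 0) γ ζ) := by
  have hγ0 : IsHomogeneousForm 0 γ := by obtain rfl | rfl := hγ <;> assumption
  have hγ' : ∀ x y, γ (bracket (F := F) x y) = 0 := by obtain rfl | rfl := hγ <;> assumption
  refine ⟨wedge_skew hγ0 hζ, fun i j k x hx y hy z hz => ?_⟩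
  simp only [wedge_apply, hγ', hζ', smul_eq_mul, mul_zero, sub_zero]
  have hodd : ∀ δ : L →ₗ[F] F, IsHomogeneousForm 0 δ → ∀ u ∈ part (F := F) (L := L) 1, δ u = 0 :=
    fun δ hδ u hu => hδ 1 (by decide) u hu
  obtain rfl | rfl := ZMod.eq_zero_or_one_of_two i
  · obtain rfl | rfl := ZMod.eq_zero_or_one_of_two j
    · obtain rfl | rfl := ZMod.eq_zero_or_one_of_two k
      · simp only [koszulSign_zero_left]
        obtain rfl | rfl := hγ <;> ring
      · simp [hodd α hα z hz, hodd β hβ z hz, hodd γ hγ0 z hz]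
    · simp [hodd α hα y hy, hodd β hβ y hy, hodd γ hγ0 y hy]
  · simp [hodd α hα x hx, hodd β hβ x hx, hodd γ hγ0 x hx]

/-- This is the evenness of the wedge, with its target placed in degree i + j, as the grading of the
central extension requires. -/
theorem wedge_eq_zero {i j k l : ZMod 2} {α β : L →ₗ[F] F} (hα : IsHomogeneousForm i α)
    (hβ : IsHomogeneousForm j β) (ε : F) {x y : L} (hx : x ∈ part (F := F) k)
    (hy : y ∈ part (F := F) l) (h : i + j ≠ k + l) : wedge ε α β x y = 0 := by
  have h1 : ∀ {i j : ZMod 2} {α β : L →ₗ[F] F}, IsHomogeneousForm i α → IsHomogeneousForm j β →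
      i + j ≠ k + l → α x * β y = 0 := by
    intro i j α β hα hβ h
    by_cases hk : k = i
    · have hl : l ≠ j := by rintro rfl; exact h (by rw [hk])
      rw [hβ l hl y hy, mul_zero]
    · rw [hα k hk x hx, zero_mul]
  rw [wedge_apply, h1 hα hβ h, h1 hβ hα (by rwa [add_comm]), mul_zero, sub_zero]

/-- The vector-valued bilinear map with given components. -/
def piForm {L : Type*} [AddCommGroup L] [Module F L] {ι : Type*} (h : ι → L →ₗ[F] L →ₗ[F] F)
    : L →ₗ[F] L →ₗ[F] (ι → F) :=
  LinearMap.mk₂ F (fun x y a => h a x y) (by intros; ext; simp) (by intros; ext; simp)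
    (by intros; ext; simp) (by intros; ext; simp)

theorem isCocycle_piForm {ι : Type*} {h : ι → L →ₗ[F] L →ₗ[F] F} (hh : ∀ a, IsCocycle (h a)) :
    IsCocycle (piForm h) :=
  ⟨fun i j x hx y hy => funext fun a => (hh a).skew i j x hx y hy,
    fun i j k x hx y hy z hz => funext fun a => (hh a).jacobi i j k x hx y hy z hz⟩

/-- The functions supported on the indices of degree `i`. -/
def piPart (F : Type u) [Field F] {ι : Type*} (d : ι → ZMod 2) (i : ZMod 2) :
    Submodule F (ι → F) where
  carrier := {f | ∀ a, d a ≠ i → f a = 0}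
  add_mem' hf hg a ha := by simp [hf a ha, hg a ha]
  zero_mem' _ _ := rfl
  smul_mem' c f hf a ha := by simp [hf a ha]

theorem isCompl_piPart {ι : Type*} (d : ι → ZMod 2) :
    IsCompl (piPart F d 0) (piPart F d 1) := by
  have h01 : (0 : ZMod 2) ≠ 1 := by decide
  constructor
  · rw [Submodule.disjoint_def]
    intro f h0 h1
    funext a
    by_cases ha : d a = 0
    · exact h1 a (by rw [ha]; exact h01)
    · exact h0 a ha
  · rw [codisjoint_iff, eq_top_iff]
    intro f _
    have hf : f = (fun a => if d a = 0 then f a else 0) + fun a => if d a = 0 then 0 else f a := by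
      funext a
      by_cases ha : d a = 0 <;> simp [ha]
    rw [hf]
    refine Submodule.add_mem_sup (fun a ha => if_neg ha) fun a ha => if_pos ?_
    exact (ZMod.eq_zero_or_one_of_two (d a)).resolve_right ha

/-- If `α_i` are homogeneous coordinates vanishing on brackets and the bracket has a component
`α_y ∧ α_w` in the direction of a further even coordinate `ζ`, then the wedge products of the
`α_i` together with `α_y ∧ ζ` and `α_w ∧ ζ` form a linearly independent family of cocycles. -/
theorem exists_isCocycle_of_coordinates (h2 : (2 : F) ≠ 0) {N q : ℕ} {d : Fin N → ZMod 2}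
    {α : Fin N → L →ₗ[F] F} {e : Fin N → L} {ζ : L →ₗ[F] F} {z : L} {y w : Fin N}
    {o : Fin q → Fin N} (hα : ∀ a, IsHomogeneousForm (d a) (α a)) (hζ : IsHomogeneousForm 0 ζ)
    (hα' : ∀ a u v, α a (bracket (F := F) u v) = 0)
    (hζ' : ∀ u v, ζ (bracket (F := F) u v) = α y u * α w v - α w u * α y v)
    (hαe : ∀ a b, α a (e b) = if a = b then 1 else 0) (hζe : ∀ a, ζ (e a) = 0)
    (hαz : ∀ a, α a z = 0) (hζz : ζ z = 1) (hy : d y = 0) (hw : d w = 0) (hyw : y ≠ w)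
    (ho : Function.Injective o) (ho' : ∀ a, d (o a) = 1) :
    ∃ (ι : Type) (_ : Fintype ι) (δ : ι → ZMod 2) (h : L →ₗ[F] L →ₗ[F] (ι → F)), IsCocycle h ∧
      (∀ i j, ∀ x ∈ part (F := F) (L := L) i, ∀ y ∈ part (F := F) (L := L) j,
        h x y ∈ piPart F δ (i + j)) ∧
      Module.finrank F (Submodule.map₂ h ⊤ ⊤) = N * (N - 1) / 2 + q + 2 := by
  classical
  let s : Fin 2 → Fin N := ![y, w]
  have hs : ∀ a, d (s a) = 0 := fun a => by fin_cases a <;> assumption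
  have hs' : Function.Injective s := by
    intro a b
    fin_cases a <;> fin_cases b <;> simp [s, hyw, hyw.symm]
  let H : ((Σ j : Fin N, Fin j) ⊕ Fin q) ⊕ Fin 2 → L →ₗ[F] L →ₗ[F] F := Sum.elim (Sum.elim
    (fun c => wedge (koszulSign F (d (c.2.castLE c.1.2.le)) (d c.1)) (α (c.2.castLE c.1.2.le))
      (α c.1))
    (fun a => wedge (koszulSign F (d (o a)) (d (o a))) (α (o a)) (α (o a))))
    (fun a => wedge (koszulSign F 0 0) (α (s a)) ζ)
  let δ : ((Σ j : Fin N, Fin j) ⊕ Fin q) ⊕ Fin 2 → ZMod 2 := Sum.elim (Sum.elim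
    (fun c => d (c.2.castLE c.1.2.le) + d c.1) (fun a => d (o a) + d (o a))) (fun _ => 0 + 0)
  have hαs : ∀ a, IsHomogeneousForm 0 (α (s a)) := fun a => by
    have := hα (s a); rwa [hs a] at this
  have hspan : Submodule.map₂ (piForm H) ⊤ ⊤ = ⊤ := by
    -- Evaluation at dual vectors isolates one component: (e i, e j) for a pair i < j, (e o, e o)
    -- for an odd square, and (e y, z) or (e w, z) for the products with ζ.
    have key : ∀ c, ∃ u v, ∃ t : F, t ≠ 0 ∧ piForm H u v = t • Pi.single c 1 := by
      have hlt : ∀ (j : Fin N) (i : Fin j), i.castLE j.2.le < j := fun j i => i.2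
      rintro ((⟨j, i⟩ | a) | a)
      · refine ⟨e (i.castLE j.2.le), e j, 1, one_ne_zero, funext ?_⟩
        rintro ((⟨j', i'⟩ | b) | b)
        · change wedge _ (α (i'.castLE j'.2.le)) (α j') _ _ = _
          -- Both index pairs are increasing, so the swapped term of the wedge can never contribute.
          have h1 : ¬ (j' = i.castLE j.2.le ∧ i'.castLE j'.2.le = j) := fun h =>
            lt_asymm (h.1 ▸ hlt j i) (h.2 ▸ hlt j' i')
          by_cases hjj : j' = j
          · subst hjj
            by_cases hii : i' = i
            · subst hii
              simp [wedge_apply, hαe, (hlt j' i').ne']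
            · simp [wedge_apply, hαe, hii, (hlt j' i').ne]
          · by_cases h : j' = i.castLE j.2.le
            · have : i'.castLE j'.2.le ≠ j := fun h' => h1 ⟨h, h'⟩
              simp [wedge_apply, hαe, hjj, this]
            · simp [wedge_apply, hαe, hjj, h]
        · change wedge _ (α (o b)) (α (o b)) _ _ = _
          by_cases h : o b = j
          · simp [wedge_apply, hαe, h, (hlt j i).ne']
          · simp [wedge_apply, hαe, h]
        · change wedge _ (α (s b)) ζ _ _ = _
          simp [wedge_apply, hζe]
      -- The sign of two odd forms is -1, so the wedge of an odd form with itself is twice its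
      -- square.
      · refine ⟨e (o a), e (o a), 2, h2, funext ?_⟩
        rintro ((⟨j', i'⟩ | b) | b)
        · change wedge _ (α (i'.castLE j'.2.le)) (α j') _ _ = _
          by_cases h : j' = o a
          · have : i'.castLE j'.2.le ≠ o a := by rw [← h]; exact (hlt j' i').ne
            simp [wedge_apply, hαe, this]
          · simp [wedge_apply, hαe, h]
        · change wedge _ (α (o b)) (α (o b)) _ _ = _
          by_cases h : b = a
          · subst h
            simp [wedge_apply, hαe, ho', koszulSign_one_one]
            norm_num
          · simp [wedge_apply, hαe, ho.ne h, h]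
        · change wedge _ (α (s b)) ζ _ _ = _
          simp [wedge_apply, hζe]
      · refine ⟨e (s a), z, 1, one_ne_zero, funext ?_⟩
        rintro ((c | b) | b)
        · change wedge _ (α _) (α _) _ _ = _
          simp [wedge_apply, hαz]
        · change wedge _ (α (o b)) (α (o b)) _ _ = _
          simp [wedge_apply, hαz]
        · change wedge _ (α (s b)) ζ _ _ = _
          by_cases h : b = a
          · subst h
            simp [wedge_apply, hαe, hζe, hζz]
          · simp [wedge_apply, hαe, hζe, hs'.ne h, h]
    rw [eq_top_iff, ← (Pi.basisFun F _).span_eq, Submodule.span_le]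
    rintro _ ⟨c, rfl⟩
    obtain ⟨u, v, t, ht, huv⟩ := key c
    rw [Pi.basisFun_apply, SetLike.mem_coe, ← Submodule.smul_mem_iff _ ht, ← huv]
    exact Submodule.apply_mem_map₂ _ trivial trivial
  refine ⟨_, inferInstance, δ, piForm H, isCocycle_piForm ?_, ?_, ?_⟩
  · rintro ((c | a) | a)
    · exact isCocycle_wedge (hα _) (hα _) (hα' _) (hα' _)
    · exact isCocycle_wedge (hα _) (hα _) (hα' _) (hα' _)
    · refine isCocycle_wedge_of_bracket (hαs 0) (hαs 1) hζ (hα' _) (hα' _) hζ' ?_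
      fin_cases a
      · exact Or.inl rfl
      · exact Or.inr rfl
  · rintro i j u hu v hv ((c | a) | a) hc
    · exact wedge_eq_zero (hα _) (hα _) _ hu hv hc
    · exact wedge_eq_zero (hα _) (hα _) _ hu hv hc
    · exact wedge_eq_zero (hαs _) hζ _ hu hv hc
  · rw [hspan, finrank_top, Module.finrank_fintype_fun_eq_card, Fintype.card_sum,
      Fintype.card_sum, Fintype.card_sigma, Fintype.card_fin, Fintype.card_fin]
    simp only [Fintype.card_fin]
    rw [Fin.sum_univ_eq_sum_range (fun i => i), Finset.sum_range_id]

end LowerBound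

/-! ### Coordinates on H(1,0) ⊕ A(a | b) -/

section Model

variable {F : Type u} [Field F] {a b : ℕ}

/-- The coordinates of `H(1, 0) ⊕ A(a | b)` that vanish on brackets. -/
def modelCoord : Option (Option (Fin a ⊕ Fin b)) → Heisenberg F 1 0 × Abelian F a b →ₗ[F] F
  | none => ⟨⟨fun x => x.1.1.1 0, fun _ _ => rfl⟩, fun _ _ => rfl⟩
  | some none => ⟨⟨fun x => x.1.1.2.1 0, fun _ _ => rfl⟩, fun _ _ => rfl⟩
  | some (some (.inl i)) => ⟨⟨fun x => x.2.1 i, fun _ _ => rfl⟩, fun _ _ => rfl⟩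
  | some (some (.inr j)) => ⟨⟨fun x => x.2.2 j, fun _ _ => rfl⟩, fun _ _ => rfl⟩

/-- The coordinate of `H(1, 0) ⊕ A(a | b)` along the derived subalgebra. -/
def modelCentralCoord : Heisenberg F 1 0 × Abelian F a b →ₗ[F] F :=
  ⟨⟨fun x => x.1.1.2.2, fun _ _ => rfl⟩, fun _ _ => rfl⟩

/-- The degrees of the coordinates `modelCoord`. -/
def modelDeg : Option (Option (Fin a ⊕ Fin b)) → ZMod 2
  | some (some (.inr _)) => 1
  | _ => 0

/-- The basis vectors dual to `modelCoord`. -/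
def modelVec : Option (Option (Fin a ⊕ Fin b)) → Heisenberg F 1 0 × Abelian F a b
  | none => (((fun _ => 1, 0, 0), 0), 0)
  | some none => (((0, fun _ => 1, 0), 0), 0)
  | some (some (.inl i)) => (0, (Pi.single i 1, 0))
  | some (some (.inr j)) => (0, (0, Pi.single j 1))

/-- The basis vector of the derived subalgebra of `H(1, 0) ⊕ A(a | b)`. -/
def modelCentralVec : Heisenberg F 1 0 × Abelian F a b := (((0, 0, 1), 0), 0)

theorem model_fst_eq_zero {x : Heisenberg F 1 0 × Abelian F a b}
    (hx : x ∈ part (F := F) (L := Heisenberg F 1 0 × Abelian F a b) 1) :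
    x.1.1 = 0 ∧ x.2.1 = 0 := ⟨hx.1.1, hx.2.1⟩

theorem model_snd_eq_zero {x : Heisenberg F 1 0 × Abelian F a b}
    (hx : x ∈ part (F := F) (L := Heisenberg F 1 0 × Abelian F a b) 0) :
    x.2.2 = 0 := hx.2.2

theorem isHomogeneousForm_modelCoord (c : Option (Option (Fin a ⊕ Fin b))) :
    IsHomogeneousForm (F := F) (modelDeg c) (modelCoord c) := by
  intro j hj x hx
  rcases c with _ | _ | i | i
  · obtain rfl := (ZMod.eq_zero_or_one_of_two j).resolve_left hj
    exact congrArg (fun t => t.1 0) (model_fst_eq_zero hx).1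
  · obtain rfl := (ZMod.eq_zero_or_one_of_two j).resolve_left hj
    exact congrArg (fun t => t.2.1 0) (model_fst_eq_zero hx).1
  · obtain rfl := (ZMod.eq_zero_or_one_of_two j).resolve_left hj
    exact congrFun (model_fst_eq_zero hx).2 i
  · obtain rfl := (ZMod.eq_zero_or_one_of_two j).resolve_right hj
    exact congrFun (model_snd_eq_zero hx) i

theorem isHomogeneousForm_modelCentralCoord :
    IsHomogeneousForm (F := F) 0 (modelCentralCoord (F := F) (a := a) (b := b)) := by
  intro j hj x hx
  obtain rfl := (ZMod.eq_zero_or_one_of_two j).resolve_left hj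
  exact congrArg (fun t => t.2.2) (model_fst_eq_zero hx).1

theorem modelCoord_bracket (c : Option (Option (Fin a ⊕ Fin b)))
    (x y : Heisenberg F 1 0 × Abelian F a b) :
    modelCoord c (bracket (F := F) x y) = 0 := by
  rcases c with _ | _ | i | i <;> rfl

theorem modelCentralCoord_bracket (x y : Heisenberg F 1 0 × Abelian F a b) :
    modelCentralCoord (bracket (F := F) x y) =
      modelCoord none x * modelCoord (some none) y
        - modelCoord (some none) x * modelCoord none y := by
  change x.1.1.1 ⬝ᵥ y.1.1.2.1 - x.1.1.2.1 ⬝ᵥ y.1.1.1 + x.1.2 ⬝ᵥ y.1.2 = x.1.1.1 0 * y.1.1.2.1 0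
    - x.1.1.2.1 0 * y.1.1.1 0
  simp [dotProduct]

theorem modelCoord_modelVec (c c' : Option (Option (Fin a ⊕ Fin b))) :
    modelCoord (F := F) c (modelVec c') = if c = c' then 1 else 0 := by
  rcases c with _ | _ | i | i <;> rcases c' with _ | _ | j | j
  case some.some.inl.some.some.inl =>
    change (Pi.single j 1 : Fin a → F) i = _
    simp [Pi.single_apply]
  case some.some.inr.some.some.inr =>
    change (Pi.single j 1 : Fin b → F) i = _
    simp [Pi.single_apply]
  all_goals rw [modelCoord, modelVec]
  all_goals simp
  all_goals rfl

theorem modelCentralCoord_modelVec (c : Option (Option (Fin a ⊕ Fin b))) :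
    modelCentralCoord (F := F) (modelVec c) = 0 := by
  rcases c with _ | _ | i | i <;> rfl

theorem modelCoord_modelCentralVec (c : Option (Option (Fin a ⊕ Fin b))) :
    modelCoord (F := F) c modelCentralVec = 0 := by
  rcases c with _ | _ | i | i <;> rfl

variable {L : Type v} [AddCommGroup L] [Module F L] [LieSuperalgebra F L]

theorem IsHomogeneousForm.comp {M : Type*} [AddCommGroup M] [Module F M] [LieSuperalgebra F M]
    {i : ZMod 2} {α : M →ₗ[F] F} (hα : IsHomogeneousForm i α) (f : Hom F L M) :
    IsHomogeneousForm i (α ∘ₗ f.toLinearMap) :=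
  fun j hj x hx => hα j hj _ (f.map_part j x hx)

/-- Coordinates pull back along f and dual vectors lift through a right inverse, so surjectivity
suffices. Two Heisenberg coordinates and a + b abelian ones vanish on brackets; b of them are odd.
-/
theorem exists_isCocycle_of_model (h2 : (2 : F) ≠ 0)
    (f : Hom F L (Heisenberg F 1 0 × Abelian F a b)) (hf : Function.Surjective f.toLinearMap) :
    ∃ (ι : Type) (_ : Fintype ι) (δ : ι → ZMod 2) (h : L →ₗ[F] L →ₗ[F] (ι → F)), IsCocycle h ∧
      (∀ i j, ∀ x ∈ part (F := F) (L := L) i, ∀ y ∈ part (F := F) (L := L) j,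
        h x y ∈ piPart F δ (i + j)) ∧
      Module.finrank F (Submodule.map₂ h ⊤ ⊤) = (a + b + 2) * (a + b + 2 - 1) / 2 + b + 2 := by
  obtain ⟨f', hf'⟩ := hf.hasRightInverse
  let σ : Option (Option (Fin a ⊕ Fin b)) ≃ Fin (a + b + 2) :=
    Fintype.equivFinOfCardEq (by simp)
  refine exists_isCocycle_of_coordinates h2 (N := a + b + 2) (q := b)
    (d := fun c => modelDeg (σ.symm c)) (α := fun c => modelCoord (σ.symm c) ∘ₗ f.toLinearMap)
    (e := fun c => f' (modelVec (σ.symm c))) (ζ := modelCentralCoord ∘ₗ f.toLinearMap)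
    (z := f' modelCentralVec) (y := σ none) (w := σ (some none))
    (o := fun j => σ (some (some (.inr j))))
    (fun c => (isHomogeneousForm_modelCoord _).comp f)
    (isHomogeneousForm_modelCentralCoord.comp f) ?_ ?_ ?_ ?_ ?_ ?_ ?_ ?_ ?_ ?_ ?_
  · intro c x y
    rw [LinearMap.comp_apply, f.map_bracket, modelCoord_bracket]
  · intro x y
    rw [LinearMap.comp_apply, f.map_bracket, modelCentralCoord_bracket]
    simp
  · intro c c'
    rw [LinearMap.comp_apply, hf', modelCoord_modelVec]
    simp
  · intro c
    rw [LinearMap.comp_apply, hf', modelCentralCoord_modelVec]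
  · intro c
    rw [LinearMap.comp_apply, hf', modelCoord_modelCentralVec]
  · rw [LinearMap.comp_apply, hf']
    rfl
  · simp [modelDeg]
  · simp [modelDeg]
  · simp
  · intro i j hij
    simpa using hij
  · intro j
    simp [modelDeg]

end Model

/-! ### Recognising H(1,0) ⊕ A(m-3 | n) -/

section Recognition

variable {F : Type u} {L : Type v} [Field F] [AddCommGroup L] [Module F L] [LieSuperalgebra F L]

theorem IsIsomorphic.symm {M : Type w} [AddCommGroup M] [Module F M] [LieSuperalgebra F M]
    (h : IsIsomorphic F L M) : IsIsomorphic F M L := by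
  obtain ⟨f, hf⟩ := h
  let e := LinearEquiv.ofBijective f.toLinearMap hf
  have he : ∀ x, f.toLinearMap (e.symm x) = x := e.apply_symm_apply
  refine ⟨⟨e.symm.toLinearMap, fun i x hx => ?_, fun x y => hf.1 ?_⟩, e.symm.bijective⟩
  · obtain ⟨y, hy, rfl⟩ := exists_homogeneous_lift f hf.2 hx
    have : e.symm (f.toLinearMap y) = y := e.symm_apply_apply y
    change e.symm _ ∈ _
    rwa [this]
  · change f.toLinearMap (e.symm _) = f.toLinearMap (bracket (F := F) (e.symm x) (e.symm y))
    rw [f.map_bracket, he, he, he]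

theorem bracket_self_of_even (h2 : (2 : F) ≠ 0) {x : L} (hx : x ∈ part (F := F) 0) :
    bracket (F := F) x x = 0 := by
  have h := skew (F := F) 0 0 x hx x hx
  rw [koszulSign_zero_left, one_smul, eq_neg_iff_add_eq_zero, ← two_smul F] at h
  exact (smul_eq_zero.1 h).resolve_left h2

variable [FiniteDimensional F L]

/-- A Lie superalgebra whose bracket is `α ∧ β` times a central even element. -/
theorem isIsomorphic_of_bracket_eq {m n : ℕ}
    (hmn : superdim F (⊤ : Submodule F L) = (m, n)) {y w z : L}
    (hy : y ∈ part (F := F) 0) (hw : w ∈ part (F := F) 0) (hz : z ∈ part (F := F) 0)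
    (hz0 : z ≠ 0) {α β : L →ₗ[F] F} (hα : IsHomogeneousForm 0 α) (hβ : IsHomogeneousForm 0 β)
    (hαy : α y = 1) (hαw : α w = 0) (hαz : α z = 0) (hβy : β y = 0) (hβw : β w = 1)
    (hβz : β z = 0)
    (hb : ∀ x x', bracket (F := F) x x' = (α x * β x' - β x * α x') • z) :
    3 ≤ m ∧ IsIsomorphic F L (Heisenberg F 1 0 × Abelian F (m - 3) n) := by
  obtain ⟨hm, hn⟩ := Prod.mk.inj hmn
  rw [top_inf_eq] at hm hn
  have hli : LinearIndependent F ![y, w, z] := by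
    rw [Fintype.linearIndependent_iff]
    intro c hc
    simp only [Fin.sum_univ_three, Matrix.cons_val] at hc
    have h0 : c 0 = 0 := by simpa [hαy, hαw, hαz] using congrArg α hc
    have h1 : c 1 = 0 := by simpa [hβy, hβw, hβz] using congrArg β hc
    have h2 : c 2 = 0 := by simpa [h0, h1, hz0] using hc
    intro i
    fin_cases i <;> assumption
  have hU : Submodule.span F (Set.range ![y, w, z]) ≤ part (F := F) 0 := by
    rw [Submodule.span_le]
    rintro _ ⟨i, rfl⟩
    fin_cases i <;> assumption
  have hUf : Module.finrank F (Submodule.span F (Set.range ![y, w, z])) = 3 := by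
    rw [finrank_span_eq_card hli, Fintype.card_fin]
  have h3 : 3 ≤ m := by
    rw [← hUf, ← hm]
    exact Submodule.finrank_mono hU
  refine ⟨h3, IsIsomorphic.symm ?_⟩
  obtain ⟨e, he, -, -, hes⟩ := exists_span_sup_eq (p := m - 3) hU (by rw [hUf, hm]; omega)
  obtain ⟨o, ho, -, -, hos⟩ := exists_span_sup_eq (p := n) (bot_le : ⊥ ≤ part (F := F) (L := L) 1)
    (by rw [hn, finrank_bot, add_zero])
  rw [bot_sup_eq] at hos
  -- Subtracting the components along y and w makes α and β vanish on the complement, so that it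
  -- becomes central.
  let e' : Fin (m - 3) → L := fun i => e i - α (e i) • y - β (e i) • w
  have hαe : ∀ i, α (e' i) = 0 := fun i => by simp [e', hαy, hαw]
  have hβe : ∀ i, β (e' i) = 0 := fun i => by simp [e', hβy, hβw]
  have hαo : ∀ i, α (o i) = 0 := fun i => hα 1 (by decide) _ (ho i)
  have hβo : ∀ i, β (o i) = 0 := fun i => hβ 1 (by decide) _ (ho i)
  have he' : ∀ i, e' i ∈ part (F := F) (L := L) 0 := fun i =>
    Submodule.sub_mem _ (Submodule.sub_mem _ (he i) (Submodule.smul_mem _ _ hy))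
      (Submodule.smul_mem _ _ hw)
  let Φ : Heisenberg F 1 0 × Abelian F (m - 3) n →ₗ[F] L :=
    (modelCoord none).smulRight y + (modelCoord (some none)).smulRight w
      + modelCentralCoord.smulRight z
      + ∑ i, (modelCoord (some (some (.inl i)))).smulRight (e' i)
      + ∑ j, (modelCoord (some (some (.inr j)))).smulRight (o j)
  have hΦ : ∀ x, Φ x = modelCoord none x • y + modelCoord (some none) x • w
      + modelCentralCoord x • z + ∑ i, modelCoord (some (some (.inl i))) x • e' i
      + ∑ j, modelCoord (some (some (.inr j))) x • o j := fun x => by simp [Φ]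
  have hαΦ : ∀ x, α (Φ x) = modelCoord none x := fun x => by
    simp [hΦ, hαy, hαw, hαz, hαe, hαo]
  have hβΦ : ∀ x, β (Φ x) = modelCoord (some none) x := fun x => by
    simp [hΦ, hβy, hβw, hβz, hβe, hβo]
  have hyr : y ∈ LinearMap.range Φ := ⟨modelVec none, by
    simp [hΦ, modelCoord_modelVec, modelCentralCoord_modelVec]⟩
  have hwr : w ∈ LinearMap.range Φ := ⟨modelVec (some none), by
    simp [hΦ, modelCoord_modelVec, modelCentralCoord_modelVec]⟩
  have hzr : z ∈ LinearMap.range Φ := ⟨modelCentralVec, by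
    simp [hΦ, modelCoord_modelCentralVec, show modelCentralCoord (F := F) (modelCentralVec
      (a := m - 3) (b := n)) = 1 from rfl]⟩
  have her : ∀ i, e i ∈ LinearMap.range Φ := fun i => by
    have h : e' i ∈ LinearMap.range Φ := ⟨modelVec (some (some (.inl i))), by
      simp [hΦ, modelCoord_modelVec, modelCentralCoord_modelVec]⟩
    have h' : e i = e' i + α (e i) • y + β (e i) • w := by simp only [e']; abel
    rw [h']
    exact Submodule.add_mem _ (Submodule.add_mem _ h (Submodule.smul_mem _ _ hyr))
      (Submodule.smul_mem _ _ hwr)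
  have hor : ∀ i, o i ∈ LinearMap.range Φ := fun i => ⟨modelVec (some (some (.inr i))), by
    simp [hΦ, modelCoord_modelVec, modelCentralCoord_modelVec]⟩
  have hsurj : Function.Surjective Φ := by
    rw [← LinearMap.range_eq_top, eq_top_iff, ← (isCompl (F := F) (L := L)).sup_eq_top, ← hes,
      ← hos]
    refine sup_le (sup_le ?_ ?_) ?_ <;> rw [Submodule.span_le] <;> rintro _ ⟨i, rfl⟩
    · fin_cases i <;> assumption
    · exact her i
    · exact hor i
  have hdim : Module.finrank F (Heisenberg F 1 0 × Abelian F (m - 3) n) = Module.finrank F L := by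
    have h1 : Module.finrank F L = m + n := by
      rw [← finrank_top, finrank_eq_add_of_superdim isGraded_top hmn]
    have h2 : Module.finrank F (Heisenberg F 1 0 × Abelian F (m - 3) n)
        = Module.finrank F ((((Fin 1 → F) × (Fin 1 → F) × F) × (Fin 0 → F)) ×
          ((Fin (m - 3) → F) × (Fin n → F))) := rfl
    rw [h1, h2]
    simp only [Module.finrank_prod, Module.finrank_fintype_fun_eq_card, Fintype.card_fin,
      Module.finrank_self]
    omega
  have hfd : FiniteDimensional F (Heisenberg F 1 0 × Abelian F (m - 3) n) :=
    inferInstanceAs (FiniteDimensional F ((((Fin 1 → F) × (Fin 1 → F) × F) × (Fin 0 → F)) ×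
          ((Fin (m - 3) → F) × (Fin n → F))))
  refine ⟨⟨Φ, ?_, ?_⟩, (LinearMap.injective_iff_surjective_of_finrank_eq_finrank hdim).2 hsurj,
    hsurj⟩
  · intro i x hx
    have h0 : ∀ c, modelDeg c ≠ i → modelCoord c x = 0 := fun c hc =>
      isHomogeneousForm_modelCoord c i hc.symm x hx
    rw [hΦ]
    obtain rfl | rfl := ZMod.eq_zero_or_one_of_two i
    · refine Submodule.add_mem _ (Submodule.add_mem _ (Submodule.add_mem _ (Submodule.add_mem _ ?_
        ?_) ?_) (Submodule.sum_mem _ fun i _ => ?_)) (Submodule.sum_mem _ fun j _ => ?_)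
      · exact Submodule.smul_mem _ _ hy
      · exact Submodule.smul_mem _ _ hw
      · exact Submodule.smul_mem _ _ hz
      · exact Submodule.smul_mem _ _ (he' i)
      · rw [h0 _ (by simp [modelDeg]), zero_smul]
        exact Submodule.zero_mem _
    · refine Submodule.add_mem _ (Submodule.add_mem _ (Submodule.add_mem _ (Submodule.add_mem _ ?_
        ?_) ?_) (Submodule.sum_mem _ fun i _ => ?_)) (Submodule.sum_mem _ fun j _ => ?_)
      · rw [h0 _ (by simp [modelDeg]), zero_smul]
        exact Submodule.zero_mem _
      · rw [h0 _ (by simp [modelDeg]), zero_smul]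
        exact Submodule.zero_mem _
      · rw [isHomogeneousForm_modelCentralCoord 1 (by decide) x hx, zero_smul]
        exact Submodule.zero_mem _
      · rw [h0 _ (by simp [modelDeg]), zero_smul]
        exact Submodule.zero_mem _
      · exact Submodule.smul_mem _ _ (ho j)
  · intro x x'
    rw [hb, hαΦ, hαΦ, hβΦ, hβΦ, hΦ]
    simp [modelCoord_bracket, modelCentralCoord_bracket]

/-- If `L'` is one-dimensional and even and `g(L', L)` has dimension at least two, then the
bracket has rank two. -/
theorem isIsomorphic_of_two_le_finrank {W : Type*} [AddCommGroup W] [Module F W] (h2 : (2 : F) ≠ 0)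
    (hL : IsNilpotent F L) {m n : ℕ} (hmn : superdim F (⊤ : Submodule F L) = (m, n))
    (hrs : superdim F (derived F L) = (1, 0)) {g : L →ₗ[F] L →ₗ[F] W} (hg : IsCocycle g)
    (hfin : 2 ≤ Module.finrank F (Submodule.map₂ g (derived F L) ⊤)) :
    3 ≤ m ∧ IsIsomorphic F L (Heisenberg F 1 0 × Abelian F (m - 3) n) := by
  have hD1 : Module.finrank F (derived F L) = 1 := finrank_eq_add_of_superdim isGraded_derived hrs
  have hD0 : derived F L ≠ ⊥ := by
    intro h
    rw [h, finrank_bot] at hD1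
    omega
  have hDeven : derived F L ≤ part (F := F) 0 := by
    have h : derived F L ⊓ part (F := F) 0 = derived F L :=
      Submodule.eq_of_le_of_finrank_eq inf_le_left (by rw [hD1]; exact (Prod.mk.inj hrs).1)
    exact inf_eq_left.1 h
  have hspan : ∀ z ∈ derived F L, z ≠ 0 → derived F L ≤ Submodule.span F {z} := by
    intro z hz hz0
    refine (Submodule.eq_of_le_of_finrank_eq
      ((Submodule.span_singleton_le_iff_mem _ _).2 hz) ?_).ge
    rw [hD1, finrank_span_singleton hz0]
  -- By nilpotency [L', L] is a proper subspace of the line L', so L' is central.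
  have hC : commutator F (derived F L) ⊤ = ⊥ := by
    have hCD : commutator F (derived F L) ⊤ ≤ derived F L := Submodule.map₂_le_map₂_left le_top
    have hlt := Submodule.finrank_lt_finrank_of_lt
      (lt_of_le_of_ne hCD fun h => not_derived_le hL hD0 h.ge)
    rw [hD1, Nat.lt_one_iff] at hlt
    exact Submodule.finrank_eq_zero.1 hlt
  have hcentral : ∀ d ∈ derived F L, ∀ x, bracket (F := F) d x = 0 := fun d hd x => by
    have : bracket (F := F) d x ∈ commutator F (derived F L) ⊤ :=
      Submodule.apply_mem_map₂ _ hd trivial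
    rwa [hC] at this
  have hcentral' : ∀ d ∈ derived F L, ∀ x, bracket (F := F) x d = 0 := fun d hd x => by
    have : bracket (F := F) x d ∈ commutator F (derived F L) ⊤ :=
      isCocycle_bracket.map₂_comm_le isGraded_top isGraded_derived
        (Submodule.apply_mem_map₂ _ trivial hd)
    rwa [hC] at this
  -- Here the hyperplane of L' is zero, so g(y, [y, w]) and g(w, [y, w]) alone span g(L', L). As its
  -- dimension is at least two, they cannot lie on a line.
  have hpair : ∀ i j, ∀ y ∈ part (F := F) (L := L) i, ∀ w ∈ part (F := F) (L := L) j,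
      bracket (F := F) y w ≠ 0 → ∀ v : W, ¬ Submodule.span F {g y (bracket (F := F) y w),
        g w (bracket (F := F) y w)} ≤ Submodule.span F {v} := by
    intro i j y hy w hw hyw v hv
    have hbot : IsGraded (⊥ : Submodule F L) := bot_le
    have h := hg.map₂_derived_le hbot hy hw
      ((hspan _ (bracket_mem_derived y w) hyw).trans le_sup_right)
    rw [Submodule.map₂_bot_left, bot_sup_eq] at h
    have h' := Submodule.finrank_mono (h.trans hv)
    have h'' : Module.finrank F (Submodule.span F {v}) ≤ 1 := by
      simpa using finrank_span_le_card (R := F) {v}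
    omega
  -- With y = w = x the two generators coincide, contrary to `hpair`.
  have hodd : ∀ x ∈ part (F := F) (L := L) 1, bracket (F := F) x x = 0 := by
    intro x hx
    by_contra h
    exact hpair 1 1 x hx x hx h (g x (bracket (F := F) x x)) (by rw [Set.pair_eq_singleton])
  have hodd' : ∀ x ∈ part (F := F) (L := L) 1, ∀ x' ∈ part (F := F) (L := L) 1,
      bracket (F := F) x x' = 0 := by
    intro x hx x' hx'
    have h := hodd _ (Submodule.add_mem _ hx hx')
    have h' := skew (F := F) 1 1 x' hx' x hx
    rw [koszulSign_one_one, neg_smul, one_smul, neg_neg] at h'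
    rw [map_add, map_add, LinearMap.add_apply, LinearMap.add_apply, hodd x hx, hodd x' hx', h',
      zero_add, add_zero, ← two_smul F] at h
    exact (smul_eq_zero.1 h).resolve_left h2
  have hev : ∀ x ∈ part (F := F) (L := L) 0, ∀ x' ∈ part (F := F) (L := L) 1,
      bracket (F := F) x x' = 0 := fun x hx x' hx' =>
    eq_zero_of_mem_parts (F := F) (hDeven (bracket_mem_derived x x')) (bracket_mem 0 1 x hx x' hx')
  have hright : ∀ x' ∈ part (F := F) (L := L) 1, ∀ x, bracket (F := F) x x' = 0 := by
    intro x' hx' x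
    obtain ⟨a, ha, b, hb, rfl⟩ := exists_add_of_part (F := F) x
    rw [map_add, LinearMap.add_apply, hev a ha x' hx', hodd' b hb x' hx', add_zero]
  have hleft : ∀ x' ∈ part (F := F) (L := L) 1, ∀ x, bracket (F := F) x' x = 0 := by
    intro x' hx' x
    obtain ⟨a, ha, b, hb, rfl⟩ := exists_add_of_part (F := F) x
    rw [map_add, hodd' x' hx' b hb, skew 1 0 x' hx' a ha, hev a ha x' hx', smul_zero, neg_zero,
      add_zero]
  obtain ⟨y, hy, w, hw, hyw⟩ : ∃ y ∈ part (F := F) (L := L) 0, ∃ w ∈ part (F := F) (L := L) 0,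
      bracket (F := F) y w ≠ 0 := by
    by_contra! hcon
    refine hD0 (le_bot_iff.1 (Submodule.map₂_le.2 fun x _ x' _ => ?_))
    obtain ⟨a, ha, b, hb, rfl⟩ := exists_add_of_part (F := F) x
    obtain ⟨a', ha', b', hb', rfl⟩ := exists_add_of_part (F := F) x'
    rw [map_add, hright b' hb', add_zero, map_add, LinearMap.add_apply, hleft b hb, add_zero,
      hcon a ha a' ha']
    exact Submodule.zero_mem _
  set z := bracket (F := F) y w with hz
  have hzD : z ∈ derived F L := bracket_mem_derived y w
  have hyy := bracket_self_of_even h2 hy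
  have hww := bracket_self_of_even h2 hw
  have hwy : bracket (F := F) w y = -z := by
    rw [skew 0 0 w hw y hy, koszulSign_zero_left, one_smul]
  -- If x, x' are orthogonal to y, Jacobi gives g(y, [x, x']) = 0. Were [x, x'] nonzero, it would
  -- span L', so g(y, z) = 0, which `hpair` forbids.
  have horth : ∀ x ∈ part (F := F) (L := L) 0, ∀ x' ∈ part (F := F) (L := L) 0,
      bracket (F := F) y x = 0 → bracket (F := F) x' y = 0 → bracket (F := F) x x' = 0 := by
    intro x hx x' hx' h1 h1'
    by_contra h
    have hgy : g y (bracket (F := F) x x') = 0 := by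
      have : g y (bracket (F := F) x x') ∈ (⊥ : Submodule F W) :=
        hg.jacobi_mem hy hx hx' (by simp [h1']) (by simp [h1])
      exact this
    obtain ⟨c, hc⟩ := Submodule.mem_span_singleton.1
      (hspan _ (bracket_mem_derived x x') h hzD)
    refine hpair 0 0 y hy w hw hyw (g w z) ?_
    rw [← hz, Submodule.span_le]
    rintro _ (rfl | rfl)
    · rw [← hc, LinearMap.map_smul (g y), hgy, smul_zero]
      exact Submodule.zero_mem _
    · exact Submodule.mem_span_singleton_self _
  obtain ⟨f, hf⟩ := Module.Projective.exists_dual_eq_one F hyw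
  have hfz : ∀ d ∈ derived F L, f d • z = d := by
    intro d hd
    obtain ⟨c, rfl⟩ := Submodule.mem_span_singleton.1 (hspan z hzD hyw hd)
    rw [map_smul, hf, smul_eq_mul, mul_one]
  let α : L →ₗ[F] F := f ∘ₗ (bracket (F := F)).flip w
  let β : L →ₗ[F] F := f ∘ₗ bracket (F := F) y
  have hα : ∀ x, α x = f (bracket (F := F) x w) := fun _ => rfl
  have hβ : ∀ x, β x = f (bracket (F := F) y x) := fun _ => rfl
  have hparts : ∀ γ : L →ₗ[F] F, (∀ x ∈ part (F := F) (L := L) 1, γ x = 0) →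
      IsHomogeneousForm 0 γ := by
    intro γ hγ j hj x hx
    obtain rfl := (ZMod.eq_zero_or_one_of_two j).resolve_left hj
    exact hγ x hx
  have hα0 : IsHomogeneousForm 0 α := hparts _ fun x hx => by rw [hα, hleft x hx, map_zero]
  have hβ0 : IsHomogeneousForm 0 β := hparts _ fun x hx => by rw [hβ, hright x hx, map_zero]
  have hαy : α y = 1 := hf
  have hβw : β w = 1 := hf
  have hαw : α w = 0 := by rw [hα, hww, map_zero]
  have hβy : β y = 0 := by rw [hβ, hyy, map_zero]
  refine isIsomorphic_of_bracket_eq hmn hy hw (hDeven hzD) hyw hα0 hβ0 hαy hαw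
    (by rw [hα, hcentral z hzD, map_zero]) hβy hβw (by rw [hβ, hcentral' z hzD, map_zero]) ?_
  have heven : ∀ x ∈ part (F := F) (L := L) 0, ∀ x' ∈ part (F := F) (L := L) 0,
      bracket (F := F) x x' = (α x * β x' - β x * α x') • z := by
    intro x hx x' hx'
    have hyb : ∀ u, bracket (F := F) y u = β u • z := fun u =>
      (hfz _ (bracket_mem_derived y u)).symm
    have hbw : ∀ u, bracket (F := F) u w = α u • z := fun u =>
      (hfz _ (bracket_mem_derived u w)).symm
    have hsk : ∀ u ∈ part (F := F) (L := L) 0, ∀ v ∈ part (F := F) (L := L) 0,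
        bracket (F := F) u v = -bracket (F := F) v u := fun u hu v hv => by
      rw [skew 0 0 u hu v hv, koszulSign_zero_left, one_smul]
    -- The map u ↦ u - β(u) w projects the even part into the orthogonal of y. Expanding the
    -- vanishing bracket of two projections yields the formula of rank two.
    have hmem : ∀ u ∈ part (F := F) (L := L) 0,
        u - β u • w ∈ part (F := F) (L := L) 0 := fun u hu =>
      Submodule.sub_mem _ hu (Submodule.smul_mem _ _ hw)
    have hker : ∀ u, bracket (F := F) y (u - β u • w) = 0 := fun u => by
      rw [map_sub, map_smul, hyb, ← hz, sub_self]
    have h := horth _ (hmem x hx) _ (hmem x' hx') (hker x)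
      (by rw [hsk _ (hmem x' hx') y hy, hker, neg_zero])
    simp only [map_sub, map_smul, LinearMap.sub_apply, LinearMap.smul_apply, hbw, hαw, zero_smul,
      hsk w hw x' hx', smul_zero, sub_zero, smul_neg, sub_neg_eq_add] at h
    linear_combination (norm := module) h
  intro x x'
  obtain ⟨a, ha, b, hb, rfl⟩ := exists_add_of_part (F := F) x
  obtain ⟨a', ha', b', hb', rfl⟩ := exists_add_of_part (F := F) x'
  have hb0 := hα0 1 (by decide) b hb
  have hb1 := hβ0 1 (by decide) b hb
  have hb0' := hα0 1 (by decide) b' hb'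
  have hb1' := hβ0 1 (by decide) b' hb'
  rw [map_add, hright b' hb', add_zero, map_add, LinearMap.add_apply, hleft b hb, add_zero,
    heven a ha a' ha']
  simp [hb0, hb1, hb0', hb1']

end Recognition

end LieSuperalgebra

/-! ### The bound and the case of equality -/

theorem mainTheorem5 {F : Type u} {L : Type v} [Field F] (hF₂ : ringChar F ≠ 2)
    (hF₃ : ringChar F ≠ 3) [AddCommGroup L] [Module F L] [LieSuperalgebra F L]
    [FiniteDimensional F L] (hL : LieSuperalgebra.IsNilpotent F L) (m n r s : ℕ)
    (hmn : LieSuperalgebra.superdim F (⊤ : Submodule F L) = (m, n))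
    (hrs : LieSuperalgebra.superdim F (LieSuperalgebra.derived F L) = (r, s))
    (h1 : 1 ≤ r + s)
    {X : Type w} (deg : X → ZMod 2)
    (ψ : LieSuperalgebra.Hom F (LieSuperalgebra.Free F deg) L)
    (hψ : Function.Surjective ψ.toLinearMap) :
    FiniteDimensional F (LieSuperalgebra.Multiplier ψ) ∧
    (Module.finrank F (LieSuperalgebra.Multiplier ψ) : ℚ)
      ≤ 1 / 2 * (((m : ℚ) + n + r + s - 2) * ((m : ℚ) + n - r - s - 1)) + n + 1 ∧
    (r + s = 1 →
      ((Module.finrank F (LieSuperalgebra.Multiplier ψ) : ℚ)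
          = 1 / 2 * (((m : ℚ) + n + r + s - 2) * ((m : ℚ) + n - r - s - 1)) + n + 1 ↔
        3 ≤ m ∧ LieSuperalgebra.IsIsomorphic F L
          (LieSuperalgebra.Heisenberg F 1 0 × LieSuperalgebra.Abelian F (m - 3) n))) := by
  have h2 : (2 : F) ≠ 0 := Ring.two_ne_zero hF₂
  have hcast : ∀ N : ℕ, ((N * (N - 1) / 2 : ℕ) : ℚ) = N * (N - 1) / 2 := fun N => by
    rw [← Nat.choose_two_right, Nat.cast_choose_two]
  obtain ⟨g, hg, hgψ, hfin, hdim⟩ := LieSuperalgebra.finrank_multiplier_add ψ hψ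
  have hk := LieSuperalgebra.finrank_eq_add_of_superdim LieSuperalgebra.isGraded_derived hrs
  rw [hk] at hdim
  obtain ⟨p, rfl⟩ : ∃ p, m = p + r := by
    obtain ⟨hm, -⟩ := Prod.mk.inj hmn
    obtain ⟨hr, -⟩ := Prod.mk.inj hrs
    obtain ⟨p, hp⟩ := Nat.exists_eq_add_of_le
      (hr ▸ hm ▸ Submodule.finrank_mono (inf_le_inf_right _ le_top) : r ≤ m)
    exact ⟨p, by omega⟩
  obtain ⟨q, rfl⟩ : ∃ q, n = q + s := by
    obtain ⟨-, hn⟩ := Prod.mk.inj hmn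
    obtain ⟨-, hs⟩ := Prod.mk.inj hrs
    obtain ⟨q, hq⟩ := Nat.exists_eq_add_of_le
      (hs ▸ hn ▸ Submodule.finrank_mono (inf_le_inf_right _ le_top) : s ≤ n)
    exact ⟨q, by omega⟩
  have hA := hg.finrank_map₂_top_le h2 hmn hrs
  have hB := hg.finrank_map₂_derived_le hL hmn hrs h1
  set G := Module.finrank F (Submodule.map₂ g ⊤ ⊤)
  set B := Module.finrank F (Submodule.map₂ g (LieSuperalgebra.derived F L) ⊤)
  set M := Module.finrank F (LieSuperalgebra.Multiplier ψ)
  have hAq : (G : ℚ) ≤ ((p : ℚ) + q) * (p + q - 1) / 2 + q + B := by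
    have := hcast (p + q)
    push_cast at this
    rw [← this]
    exact_mod_cast hA
  have hBq : (B : ℚ) ≤ ((r : ℚ) + s - 1) * (p + q) + 2 := by
    have : ((r + s - 1 : ℕ) : ℚ) = (r : ℚ) + s - 1 := by push_cast [Nat.cast_sub h1]; ring
    rw [← this]
    exact_mod_cast hB
  have hdimq : (M : ℚ) + (r + s) = G := by exact_mod_cast hdim
  have hs0 : (0 : ℚ) ≤ s := Nat.cast_nonneg s
  -- The estimates `hAq` and `hBq` give the right-hand side with s subtracted; the term s ≥ 0 is
  -- discarded.
  have hbound : (M : ℚ) ≤ 1 / 2 * ((((p + r : ℕ) : ℚ) + (q + s : ℕ) + r + s - 2) *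
      (((p + r : ℕ) : ℚ) + (q + s : ℕ) - r - s - 1)) + (q + s : ℕ) + 1 := by
    push_cast
    linarith
  refine ⟨hfin, hbound, fun hrs1 => ⟨fun heq => ?_, ?_⟩⟩
  · have hrsq : (r : ℚ) + s = 1 := by exact_mod_cast hrs1
    have hr : (r : ℚ) = 1 - s := by linarith
    push_cast at heq
    rw [hr] at heq hBq hdimq
    -- Equality leaves no room for the discarded s: B must reach s + 2, while B ≤ 2. Hence s = 0 and
    -- B = 2.
    have hsB : (s : ℚ) + 2 ≤ B := by linarith
    have hsB' : s + 2 ≤ B := by exact_mod_cast hsB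
    have hB2 : B ≤ 2 := by simpa [hrs1] using hB
    obtain rfl : s = 0 := by omega
    obtain rfl : r = 1 := by omega
    exact LieSuperalgebra.isIsomorphic_of_two_le_finrank h2 hL hmn hrs hg (by omega)
  · rintro ⟨h3, f, hf⟩
    refine le_antisymm hbound ?_
    obtain ⟨ι, _, δ, h, hh, hδ, hrank⟩ := LieSuperalgebra.exists_isCocycle_of_model h2 f hf.2
    have hle := LieSuperalgebra.finrank_map₂_le_of_free ψ hψ hgψ (LieSuperalgebra.piPart F δ)
      (LieSuperalgebra.isCompl_piPart δ) h hh hδ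
    -- Since r + s = 1, the model has p + q coordinates vanishing on brackets. Its q + s odd
    -- coordinates produce the extra s needed to meet the bound.
    rw [hrank, show p + r - 3 + (q + s) + 2 = p + q by omega] at hle
    have hleq : ((p : ℚ) + q) * (p + q - 1) / 2 + (q + s) + 2 ≤ G := by
      have := hcast (p + q)
      push_cast at this
      rw [← this]
      exact_mod_cast hle
    have hrsq : (r : ℚ) + s = 1 := by exact_mod_cast hrs1
    have hr : (r : ℚ) = 1 - s := by linarith
    push_cast
    rw [hr] at hdimq ⊢
    linarith
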